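/- Let $k$ be a local field of characteristic zero (archimedean or not); all topological $k$-vector spaces are locally convex. An (FN)-space is a nuclear Fréchet space, a (DFN)-space is a space isomorphic to the strong dual of an (FN)-space, and an analytic Tate space is a topological vector space $V$ that has a topological direct sum decomposition $V = L \oplus G$ with $L$ an (FN)-space and $G$ a (DFN)-space. A continuous linear map $f\colon E \to F$ is nuclear if $f(x) = \sum_n \lambda_n \ell_n(x) y_n$ for all $x$, where $(\ell_n)$ is an equicontinuous sequence of linear forms on $E$, $(y_n)$ lies in a Banach disc of $F$, and $\sum_n |\lambda_n| < \infty$ if $k$ is archimedean, resp. $\lambda_n \to 0$ if $k$ is non-archimedean. Two topological direct sum decompositions $V = V_+ \oplus V_- = W_+ \oplus W_-$ are called equivalent if for $\{i,j\} = \{+,-\}$ the compositions $V_i \hookrightarrow V \twoheadrightarrow W_j$ and $W_i \hookrightarrow V \twoheadrightarrow V_j$ (inclusions followed by the projections of the decompositions) are nuclear; a polarization of $V$ is an equivalence class of decompositions, and its members are called allowable. For a polarized space $V$, $GL(V)$ is the group of bicontinuous linear automorphisms of $V$, and $GL_{res}(V)$ consists of those $g \in GL(V)$ for which the components $g_{+,-}\colon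 V_+ \to V_-$ and $g_{-,+}\colon V_- \to V_+$ with respect to the allowable decompositions $V = V_+ \oplus V_-$ are nuclear. Let $V$ be an analytic Tate space. (i) If $V = V_+ \oplus V_- = W_+ \oplus W_-$ are two topological direct sum decompositions in which $V_+, W_+$ are (FN)-spaces and $V_-, W_-$ are (DFN)-spaces, then they are equivalent. Consequently there is exactly one polarization of $V$ that is the class of such a decomposition. (ii) With respect to this polarization, $GL(V) = GL_{res}(V)$. -/

import Mathlib

open Topology Filter Pointwise

noncomputable section

namespace AnalyticTate

universe u v w

/-- A local field of characteristic zero with its absolute value: a locally compact field of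
characteristic zero which is either non-archimedean, or `ℝ` or `ℂ` with the usual absolute value
(expressed by saying that the given normed field structure is that of an `RCLike` field; this
excludes such absolute values as `|x| ^ (1 / 2)` on `ℝ`). -/
structure IsLocalFieldCharZero (k : Type u) [inst : NontriviallyNormedField k] : Prop where
  charZero : CharZero k
  locallyCompact : LocallyCompactSpace k
  nonarch_or_arch : IsUltrametricDist k ∨
    ∃ r : RCLike k, r.toDenselyNormedField.toNontriviallyNormedField = inst

section Convexity

variable (k : Type u) [NontriviallyNormedField k]
variable {V : Type v} [AddCommGroup V] [Module k V]

/-- The seminorms of the theory of locally convex spaces over `k`: all seminorms if `k` is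
archimedean, those satisfying the strong triangle inequality if `k` is non-archimedean. -/
def IsConvexSeminorm (p : Seminorm k V) : Prop :=
  IsUltrametricDist k → ∀ x y : V, p (x + y) ≤ max (p x) (p y)

/-- Absolutely convex sets (discs): nonempty, and convex and balanced if `k` is archimedean,
resp. submodules over the ring of integers if `k` is non-archimedean. -/
def IsDisc (B : Set V) : Prop :=
  B.Nonempty ∧ ∀ x ∈ B, ∀ y ∈ B, ∀ a b : k,
    (‖a‖ + ‖b‖ ≤ 1 ∨ (IsUltrametricDist k ∧ ‖a‖ ≤ 1 ∧ ‖b‖ ≤ 1)) → a • x + b • y ∈ B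

variable (V) in
/-- The topology of `V` is locally convex: it is defined by the continuous (non-archimedean, if
`k` is) seminorms. -/
def IsLocallyConvex [TopologicalSpace V] : Prop :=
  ∀ U ∈ 𝓝 (0 : V), ∃ p : Seminorm k V,
    IsConvexSeminorm k p ∧ Continuous p ∧ {x | p x < 1} ⊆ U

/-- A Banach disc: a bounded disc `B` such that the span of `B`, normed by the gauge of `B`, is
complete. The sets `a • B`, `a ≠ 0`, form a basis of neighbourhoods of zero for the gauge. -/
structure IsBanachDisc [TopologicalSpace V] (B : Set V) : Prop where
  disc : IsDisc k B
  bounded : Bornology.IsVonNBounded k B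
  complete : ∀ s : ℕ → V, (∀ n, s n ∈ Submodule.span k B) →
    (∀ a : k, a ≠ 0 → ∃ N, ∀ m ≥ N, ∀ n ≥ N, s m - s n ∈ a • B) →
    ∃ x ∈ Submodule.span k B, ∀ a : k, a ≠ 0 → ∃ N, ∀ n ≥ N, s n - x ∈ a • B

end Convexity

section Nuclear

variable {k : Type u} [NontriviallyNormedField k]

/-- Nuclear maps: `f x = ∑ λₙ ℓₙ(x) yₙ` with `∑ λₙ` convergent, `(ℓₙ)` an equicontinuous sequence
of linear forms and `(yₙ)` a sequence in a Banach disc of the target. Unconditional convergence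
of `∑ λₙ` in `k` means `∑ |λₙ| < ∞` if `k` is archimedean and `λₙ → 0` if it is
non-archimedean, so that this is the usual definition in both cases. -/
def IsNuclearMap {V : Type v} [AddCommGroup V] [Module k V] [TopologicalSpace V]
    {W : Type w} [AddCommGroup W] [Module k W] [TopologicalSpace W] (f : V →L[k] W) : Prop :=
  ∃ (lam : ℕ → k) (l : ℕ → V →L[k] k) (y : ℕ → W) (B : Set W),
    Summable lam ∧ Equicontinuous (fun n => (l n : V → k)) ∧
    IsBanachDisc k B ∧ (∀ n, y n ∈ B) ∧
    ∀ x, HasSum (fun n => (lam n * l n x) • y n) (f x)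

variable {V : Type v} [AddCommGroup V] [Module k V]

/-- The space `V` endowed with the seminorm `p`. -/
def WithSeminorm (_p : Seminorm k V) : Type v := V

instance (p : Seminorm k V) : SeminormedAddCommGroup (WithSeminorm p) :=
  (p.toAddGroupSeminorm.toSeminormedAddCommGroup : SeminormedAddCommGroup V)

instance (p : Seminorm k V) : Module k (WithSeminorm p) :=
  inferInstanceAs (Module k V)

instance (p : Seminorm k V) : NormedSpace k (WithSeminorm p) where
  norm_smul_le a x := (map_smul_eq_mul p a x).le

/-- The Banach space attached to a seminorm `p` on `V`: the Hausdorff completion of `(V, p)`. -/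
abbrev LocalBanach (p : Seminorm k V) : Type v := UniformSpace.Completion (WithSeminorm p)

/-- The canonical map from `V` to the Banach space attached to `p`. -/
def toLocalBanach (p : Seminorm k V) (x : V) : LocalBanach p :=
  ((show WithSeminorm p from x : WithSeminorm p) : UniformSpace.Completion (WithSeminorm p))

variable (k V) in
/-- Nuclear spaces: for every continuous seminorm `p` there is a continuous seminorm `q ≥ p` such
that the canonical map from the Banach space of `q` to that of `p` (the unique continuous linear
map extending the identity of `V`) is nuclear. -/
def IsNuclearSpace [TopologicalSpace V] : Prop :=
  ∀ p : Seminorm k V, IsConvexSeminorm k p → Continuous p →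
    ∃ q : Seminorm k V, IsConvexSeminorm k q ∧ Continuous q ∧ p ≤ q ∧
      ∃ T : LocalBanach q →L[k] LocalBanach p,
        (∀ x : V, T (toLocalBanach q x) = toLocalBanach p x) ∧ IsNuclearMap T

end Nuclear

section Spaces

variable (k : Type u) [NontriviallyNormedField k]

/-- Nuclear Fréchet spaces. -/
structure IsFN (V : Type v) [AddCommGroup V] [Module k V] [TopologicalSpace V]
    [IsTopologicalAddGroup V] : Prop where
  continuousSMul : ContinuousSMul k V
  locallyConvex : IsLocallyConvex k V
  t2 : T2Space V
  firstCountable : FirstCountableTopology V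
  complete : @CompleteSpace V (IsTopologicalAddGroup.rightUniformSpace V)
  nuclear : IsNuclearSpace k V

/-- Spaces isomorphic to the strong dual of a nuclear Fréchet space. In Mathlib `StrongDual k F`
carries the topology of uniform convergence on bounded sets. -/
def IsDFN (V : Type v) [AddCommGroup V] [Module k V] [TopologicalSpace V] : Prop :=
  ∃ (F : Type (max u v)) (_ : AddCommGroup F) (_ : Module k F) (_ : TopologicalSpace F)
    (_ : IsTopologicalAddGroup F), IsFN k F ∧ Nonempty (V ≃L[k] StrongDual k F)

end Spaces

section Polarizations

variable (k : Type u) [NontriviallyNormedField k]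
variable (V : Type v) [AddCommGroup V] [Module k V] [TopologicalSpace V]

/-- A topological direct sum decomposition `V = V₊ ⊕ V₋`. -/
structure Decomposition where
  plus : Submodule k V
  minus : Submodule k V
  isTopCompl : Submodule.IsTopCompl plus minus

variable {k V} [IsTopologicalAddGroup V]

namespace Decomposition

/-- The projection `V ↠ V₊`. -/
def projPlus (D : Decomposition k V) : V →L[k] D.plus :=
  D.plus.projectionOntoL D.minus D.isTopCompl

/-- The projection `V ↠ V₋`. -/
def projMinus (D : Decomposition k V) : V →L[k] D.minus :=
  D.minus.projectionOntoL D.plus D.isTopCompl.symm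

/-- Equivalence of decompositions: for opposite signs `i`, `j` the compositions `Vᵢ ↪ V ↠ Wⱼ` and
`Wᵢ ↪ V ↠ Vⱼ` are nuclear. -/
def Equivalent (D E : Decomposition k V) : Prop :=
  IsNuclearMap (E.projMinus ∘L D.plus.subtypeL) ∧
  IsNuclearMap (E.projPlus ∘L D.minus.subtypeL) ∧
  IsNuclearMap (D.projMinus ∘L E.plus.subtypeL) ∧
  IsNuclearMap (D.projPlus ∘L E.minus.subtypeL)

/-- The equivalence class of a decomposition. Such a class is a polarization of `V`; its elements
are the allowable decompositions. -/
def polarization (D : Decomposition k V) : Set (Decomposition k V) :=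
  {E | D.Equivalent E}

/-- The decomposition has a nuclear Fréchet plus-summand and as minus-summand the strong dual of a
nuclear Fréchet space. -/
def IsTate (D : Decomposition k V) : Prop :=
  IsFN k D.plus ∧ IsDFN k D.minus

end Decomposition

/-- The restricted linear group of `V` with respect to a polarization: the bicontinuous
automorphisms `g` whose components `V₊ → V₋` and `V₋ → V₊` are nuclear for the allowable
decompositions `V = V₊ ⊕ V₋`. -/
def GLres (P : Set (Decomposition k V)) : Set (V ≃L[k] V) :=
  {g | ∀ D ∈ P,
    IsNuclearMap (D.projMinus ∘L (g : V →L[k] V) ∘L D.plus.subtypeL) ∧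
    IsNuclearMap (D.projPlus ∘L (g : V →L[k] V) ∘L D.minus.subtypeL)}

variable (k V) in
/-- Analytic Tate spaces. -/
def IsAnalyticTateSpace : Prop :=
  IsLocallyConvex k V ∧ ∃ D : Decomposition k V, D.IsTate

/-- The polarizations defined by an analytic Tate space structure. -/
def IsTatePolarization (P : Set (Decomposition k V)) : Prop :=
  ∃ D : Decomposition k V, D.IsTate ∧ P = D.polarization

end Polarizations

end AnalyticTate

end

/-!
The off-diagonal maps in question are continuous linear maps from an (FN)-space to a (DFN)-space or
the other way round, and all of these are nuclear; the ideal property of nuclear maps gives the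
rest.

A map `E → F'` into the strong dual of a Fréchet space is a separately continuous bilinear form on
`E × F`, hence jointly continuous by the Banach–Steinhaus theorem, so that it is bounded on a
neighbourhood of zero. A map `F' → L` into a metrizable space is bounded on a neighbourhood of zero
because a sequence of bounded sets of `F` can be rescaled so as to have a bounded union.

A map that is bounded on a neighbourhood of zero and starts from a nuclear space factors through one
of the nuclear maps between local Banach spaces. For a map `f` into a nuclear Fréchet space `L` this
factorization only gives nuclearity for each seminorm of `L` separately. Take a fundamental sequence
`p₀ ≤ p₁ ≤ ⋯` such that `L_{pₘ₊₁} → L_{pₘ}` is nuclear, and finite-rank maps `gₘ → f` approximating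
`f` so fast that `gₘ₊₁ - gₘ` has a finite nuclear expansion with coefficients of norm at most
`2⁻ᵐ` and vectors in the unit ball of `pₘ₊₁`. All but finitely many of the vectors occurring in the
telescoping series lie in the unit ball of any given `pⱼ`, so that together they lie in one Banach
disc, and the series is a nuclear expansion of `f`.
-/

noncomputable section

namespace AnalyticTate

section Gauge

variable {k : Type*} [NontriviallyNormedField k]
variable {V : Type*} [AddCommGroup V] [Module k V]
variable {W : Type*} [AddCommGroup W] [Module k W]
variable {A B : Set V} {a b c : k} {x y : V} {s : ℕ → V}

theorem IsDisc.zero_mem (hB : IsDisc k B) : (0 : V) ∈ B := by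
  obtain ⟨x, hx⟩ := hB.1
  simpa using hB.2 x hx x hx 0 0 (by simp)

theorem IsDisc.smul_mem (hB : IsDisc k B) (hx : x ∈ B) (ha : ‖a‖ ≤ 1) : a • x ∈ B := by
  simpa using hB.2 x hx x hx a 0 (by simp [ha])

theorem IsDisc.neg_mem (hB : IsDisc k B) (hx : x ∈ B) : -x ∈ B := by
  simpa using hB.smul_mem hx (a := -1) (by simp)

theorem IsDisc.smul_set_mono (hB : IsDisc k B) (hb : b ≠ 0) (hab : ‖a‖ ≤ ‖b‖) :
    a • B ⊆ b • B := by
  rintro _ ⟨x, hx, rfl⟩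
  refine ⟨(b⁻¹ * a) • x, hB.smul_mem hx ?_, by simp [smul_smul, hb]⟩
  rwa [norm_mul, norm_inv, inv_mul_le_iff₀ (norm_pos_iff.2 hb), mul_one]

theorem IsDisc.neg_mem_smul (hB : IsDisc k B) (hx : x ∈ a • B) : -x ∈ a • B := by
  obtain ⟨y, hy, rfl⟩ := hx
  exact ⟨-y, hB.neg_mem hy, by simp⟩

theorem IsDisc.add_mem_smul (hB : IsDisc k B) (hc : ‖c‖ ≤ 1 / 2)
    (hx : x ∈ (a * c) • B) (hy : y ∈ (a * c) • B) : x + y ∈ a • B := by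
  obtain ⟨x, hx, rfl⟩ := hx
  obtain ⟨y, hy, rfl⟩ := hy
  exact ⟨c • x + c • y, hB.2 x hx y hy c c (Or.inl (by linarith)), by simp [smul_smul]⟩

theorem IsDisc.image (hB : IsDisc k B) (u : V →ₗ[k] W) : IsDisc k (u '' B) := by
  refine ⟨hB.1.image u, ?_⟩
  rintro _ ⟨x, hx, rfl⟩ _ ⟨y, hy, rfl⟩ a b hab
  exact ⟨a • x + b • y, hB.2 x hx y hy a b hab, by simp⟩

theorem IsDisc.prod {B' : Set W} (hB : IsDisc k B) (hB' : IsDisc k B') : IsDisc k (B ×ˢ B') :=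
  ⟨hB.1.prod hB'.1, fun x hx y hy a b hab =>
    ⟨hB.2 x.1 hx.1 y.1 hy.1 a b hab, hB'.2 x.2 hx.2 y.2 hy.2 a b hab⟩⟩

variable (k) in
theorem exists_ne_zero_norm_le_half : ∃ c : k, c ≠ 0 ∧ ‖c‖ ≤ 1 / 2 := by
  obtain ⟨c, hc0, hc⟩ := NormedField.exists_norm_lt k (r := 1 / 2) (by norm_num)
  exact ⟨c, norm_pos_iff.1 hc0, hc.le⟩

variable (k) in
/-- The Cauchy sequences for the gauge of a disc `B`, in the form used in `IsBanachDisc`: the sets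
`a • B` with `a ≠ 0` play the role of the balls. -/
def GaugeCauchy (B : Set V) (s : ℕ → V) : Prop :=
  ∀ a : k, a ≠ 0 → ∃ N, ∀ m ≥ N, ∀ n ≥ N, s m - s n ∈ a • B

variable (k) in
/-- Convergence to `x` for the gauge of a disc `B`, in the form used in `IsBanachDisc`. -/
def GaugeTendsto (B : Set V) (s : ℕ → V) (x : V) : Prop :=
  ∀ a : k, a ≠ 0 → ∃ N, ∀ n ≥ N, s n - x ∈ a • B

theorem GaugeCauchy.mono (hs : GaugeCauchy k A s) (hAB : A ⊆ B) : GaugeCauchy k B s :=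
  fun a ha => (hs a ha).imp fun _ hN m hm n hn => Set.smul_set_mono hAB (hN m hm n hn)

theorem GaugeCauchy.map (hs : GaugeCauchy k B s) (u : V →ₗ[k] W) :
    GaugeCauchy k (u '' B) (u ∘ s) := fun a ha =>
  (hs a ha).imp fun _ hN m hm n hn => by
    rw [Function.comp_apply, Function.comp_apply, ← map_sub, ← image_smul_set]
    exact Set.mem_image_of_mem u (hN m hm n hn)

theorem GaugeTendsto.map (hs : GaugeTendsto k B s x) (u : V →ₗ[k] W) :
    GaugeTendsto k (u '' B) (u ∘ s) (u x) := fun a ha =>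
  (hs a ha).imp fun _ hN n hn => by
    rw [Function.comp_apply, ← map_sub, ← image_smul_set]
    exact Set.mem_image_of_mem u (hN n hn)

theorem GaugeTendsto.prodMk {B' : Set W} {s' : ℕ → W} {x' : W} (hs : GaugeTendsto k B s x)
    (hs' : GaugeTendsto k B' s' x') :
    GaugeTendsto k (B ×ˢ B') (fun n => (s n, s' n)) (x, x') := fun a ha => by
  obtain ⟨N, hN⟩ := hs a ha
  obtain ⟨N', hN'⟩ := hs' a ha
  refine ⟨max N N', fun n hn => ?_⟩
  rw [Set.smul_set_prod]
  exact ⟨hN n (le_of_max_le_left hn), hN' n (le_of_max_le_right hn)⟩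

theorem GaugeTendsto.mem_span (hs : GaugeTendsto k B s x)
    (hmem : ∀ n, s n ∈ Submodule.span k B) : x ∈ Submodule.span k B := by
  obtain ⟨N, hN⟩ := hs 1 one_ne_zero
  have hsub : s N - x ∈ Submodule.span k B :=
    Submodule.subset_span (by simpa using hN N le_rfl)
  simpa using Submodule.sub_mem _ (hmem N) hsub

theorem GaugeCauchy.gaugeTendsto_of_comp {φ : ℕ → ℕ} (hs : GaugeCauchy k B s) (hB : IsDisc k B)
    (hφ : StrictMono φ) (hlim : GaugeTendsto k B (s ∘ φ) x) : GaugeTendsto k B s x := by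
  intro a ha
  obtain ⟨c, hc0, hc⟩ := exists_ne_zero_norm_le_half k
  obtain ⟨N, hN⟩ := hs (a * c) (mul_ne_zero ha hc0)
  obtain ⟨M, hM⟩ := hlim (a * c) (mul_ne_zero ha hc0)
  refine ⟨N, fun n hn => ?_⟩
  have hclose := hN n hn (φ (max N M)) ((le_max_left N M).trans hφ.le_apply)
  simpa using hB.add_mem_smul hc hclose (hM (max N M) (le_max_right N M))

theorem GaugeCauchy.exists_strictMono (hs : GaugeCauchy k B s) (hc : c ≠ 0) :
    ∃ φ : ℕ → ℕ, StrictMono φ ∧ ∀ j, s (φ (j + 1)) - s (φ j) ∈ c ^ j • B := by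
  obtain ⟨φ, hφ, h⟩ := extraction_forall_of_eventually'
    (P := fun j N => ∀ m ≥ N, s m - s N ∈ c ^ j • B) fun j => by
      obtain ⟨N, hN⟩ := hs (c ^ j) (pow_ne_zero j hc)
      exact ⟨N, fun n hn m hm => hN m (hn.trans hm) n hn⟩
  exact ⟨φ, hφ, fun j => h j _ (hφ j.lt_succ_self).le⟩

theorem IsDisc.sub_mem_smul_of_succ (hB : IsDisc k B) (hc0 : c ≠ 0) (hc : ‖c‖ ≤ 1 / 2)
    (hs : ∀ j, s (j + 1) - s j ∈ c ^ j • B) (n l : ℕ) :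
    s (n + l) - s n ∈ (c ^ n * c⁻¹) • B := by
  induction l generalizing n with
  | zero => exact ⟨0, hB.zero_mem, by simp⟩
  | succ l ih =>
    have hmem := ih (n + 1)
    rw [show c ^ (n + 1) * c⁻¹ = c ^ n * c⁻¹ * c by ring, show n + 1 + l = n + (l + 1) by ring]
      at hmem
    simpa using hB.add_mem_smul hc hmem (y := s (n + 1) - s n) (by simpa [hc0] using hs n)

theorem IsDisc.gaugeCauchy_of_succ (hB : IsDisc k B) (hc0 : c ≠ 0) (hc : ‖c‖ ≤ 1 / 2)
    (hs : ∀ j, s (j + 1) - s j ∈ c ^ j • B) : GaugeCauchy k B s := by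
  intro a ha
  have hpos : 0 < ‖a * c‖ := norm_pos_iff.2 (mul_ne_zero ha hc0)
  obtain ⟨N, hN⟩ := exists_pow_lt_of_lt_one hpos (y := ‖c‖) (by linarith)
  have hmem (n) (hn : N ≤ n) (l) : s (n + l) - s n ∈ a • B := by
    refine hB.smul_set_mono ha ?_ (hB.sub_mem_smul_of_succ hc0 hc hs n l)
    rw [norm_mul, norm_inv, mul_inv_le_iff₀ (norm_pos_iff.2 hc0), ← norm_mul, norm_pow]
    exact (pow_le_pow_of_le_one (norm_nonneg c) (by linarith) hn).trans hN.le
  refine ⟨N, fun m hm n hn => ?_⟩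
  rcases le_total n m with h | h <;> obtain ⟨l, rfl⟩ := Nat.exists_eq_add_of_le h
  · exact hmem n hn l
  · simpa using hB.neg_mem_smul (hmem m hm l)

theorem GaugeCauchy.cauchySeq [UniformSpace V] [IsUniformAddGroup V] (hs : GaugeCauchy k B s)
    (hB : Bornology.IsVonNBounded k B) : CauchySeq s := by
  rw [cauchySeq_iff_tendsto, uniformity_eq_comap_nhds_zero, tendsto_comap_iff]
  intro U hU
  obtain ⟨c, hc0, hcU⟩ : ∃ c : k, c ≠ 0 ∧ c • B ⊆ U := by
    obtain ⟨b, hb, hb0⟩ := ((hB hU).and (Bornology.eventually_ne_cobounded 0)).exists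
    exact ⟨b⁻¹, inv_ne_zero hb0, (Set.smul_set_subset_iff₀ (inv_ne_zero hb0)).2 (by simpa using hb)⟩
  obtain ⟨N, hN⟩ := hs c hc0
  exact (eventually_ge_atTop (N, N)).mono fun n hn => hcU (hN n.2 hn.2 n.1 hn.1)

theorem GaugeCauchy.gaugeTendsto_of_tendsto [TopologicalSpace V] [IsTopologicalAddGroup V]
    [ContinuousConstSMul k V] (hs : GaugeCauchy k B s) (hB : IsClosed B)
    (hx : Tendsto s atTop (𝓝 x)) : GaugeTendsto k B s x := by
  intro a ha
  obtain ⟨N, hN⟩ := hs a ha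
  refine ⟨N, fun n hn => (hB.smul_of_ne_zero ha).mem_of_tendsto (tendsto_const_nhds.sub hx) ?_⟩
  filter_upwards [eventually_ge_atTop N] with m hm
  exact hN n hn m hm

end Gauge

section BanachDisc

variable {k : Type*} [NontriviallyNormedField k]
variable {V : Type*} [AddCommGroup V] [Module k V]
variable {W : Type*} [AddCommGroup W] [Module k W]

theorem IsDisc.isBanachDisc_of_isClosed [UniformSpace V] [IsUniformAddGroup V] [CompleteSpace V]
    [ContinuousConstSMul k V] {B : Set V} (hdisc : IsDisc k B)
    (hbdd : Bornology.IsVonNBounded k B) (hclosed : IsClosed B) : IsBanachDisc k B where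
  disc := hdisc
  bounded := hbdd
  complete s hmem hs := by
    obtain ⟨x, hx⟩ := cauchySeq_tendsto_of_complete (GaugeCauchy.cauchySeq hs hbdd)
    have hlim := GaugeCauchy.gaugeTendsto_of_tendsto hs hclosed hx
    exact ⟨x, hlim.mem_span hmem, hlim⟩

-- A Cauchy sequence in the image has a rapidly converging subsequence, and its successive
-- differences can be lifted to the terms of a geometric series.
theorem IsBanachDisc.image [TopologicalSpace V] [TopologicalSpace W] {B : Set V}
    (hB : IsBanachDisc k B) (u : V →L[k] W) : IsBanachDisc k (u '' B) where
  disc := hB.disc.image (u : V →ₗ[k] W)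
  bounded := hB.bounded.image u
  complete s hmem hs := by
    obtain ⟨c, hc0, hc⟩ := exists_ne_zero_norm_le_half k
    obtain ⟨φ, hφ, hsub⟩ := GaugeCauchy.exists_strictMono hs hc0
    choose b hb hbs using fun j => show ∃ b ∈ B, s (φ (j + 1)) - s (φ j) = u (c ^ j • b) by
      obtain ⟨_, ⟨b, hb, rfl⟩, h⟩ := hsub j
      exact ⟨b, hb, by simpa using h.symm⟩
    obtain ⟨w, hw, hws⟩ : ∃ w ∈ Submodule.span k B, u w = s (φ 0) := by
      have hmem₀ := hmem (φ 0)
      rwa [← ContinuousLinearMap.coe_coe u, ← Submodule.map_span, Submodule.mem_map] at hmem₀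
    let v : ℕ → V := fun j => w + ∑ i ∈ Finset.range j, c ^ i • b i
    have hvs : u ∘ v = s ∘ φ := funext fun j => by
      simp only [v, Function.comp_apply, map_add, map_sum, ← hbs, hws]
      rw [Finset.sum_range_sub (fun j => s (φ j)), add_sub_cancel]
    have hv : GaugeCauchy k B v := hB.disc.gaugeCauchy_of_succ hc0 hc fun j => by
      simpa [v, Finset.sum_range_succ] using Set.smul_mem_smul_set (hb j)
    have hvmem : ∀ j, v j ∈ Submodule.span k B := fun j =>
      add_mem hw (sum_mem fun i _ => Submodule.smul_mem _ _ (Submodule.subset_span (hb i)))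
    obtain ⟨x, -, hx⟩ := hB.complete v hvmem hv
    have hlim : GaugeTendsto k (u '' B) (s ∘ φ) (u x) :=
      hvs ▸ GaugeTendsto.map hx (u : V →ₗ[k] W)
    have hlim' := GaugeCauchy.gaugeTendsto_of_comp hs (hB.disc.image (u : V →ₗ[k] W)) hφ hlim
    exact ⟨u x, hlim'.mem_span hmem, hlim'⟩

theorem isVonNBounded_prod [TopologicalSpace V] [TopologicalSpace W] {A : Set V} {B : Set W}
    (hA : Bornology.IsVonNBounded k A) (hB : Bornology.IsVonNBounded k B) :
    Bornology.IsVonNBounded k (A ×ˢ B) := by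
  intro U hU
  obtain ⟨U₁, hU₁, U₂, hU₂, hU⟩ := mem_nhds_prod_iff.1 hU
  filter_upwards [hA hU₁, hB hU₂] with a h₁ h₂
  exact (Set.prod_mono h₁ h₂).trans (by rw [← Set.smul_set_prod]; exact Set.smul_set_mono hU)

theorem IsBanachDisc.prod [TopologicalSpace V] [TopologicalSpace W] {A : Set V} {B : Set W}
    (hA : IsBanachDisc k A) (hB : IsBanachDisc k B) : IsBanachDisc k (A ×ˢ B) where
  disc := hA.disc.prod hB.disc
  bounded := isVonNBounded_prod hA.bounded hB.bounded
  complete s hmem hs := by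
    have hspan : Submodule.span k (A ×ˢ B) ≤ (Submodule.span k A).prod (Submodule.span k B) :=
      Submodule.span_le.2 (Set.prod_mono Submodule.subset_span Submodule.subset_span)
    have hfst := (GaugeCauchy.map hs (LinearMap.fst k V W)).mono (Set.fst_image_prod_subset A B)
    have hsnd := (GaugeCauchy.map hs (LinearMap.snd k V W)).mono (Set.snd_image_prod_subset A B)
    obtain ⟨x, -, hx⟩ := hA.complete _ (fun n => (hspan (hmem n)).1) hfst
    obtain ⟨y, -, hy⟩ := hB.complete _ (fun n => (hspan (hmem n)).2) hsnd
    have hlim : GaugeTendsto k (A ×ˢ B) s (x, y) := GaugeTendsto.prodMk hx hy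
    exact ⟨(x, y), hlim.mem_span hmem, hlim⟩

theorem IsBanachDisc.add [TopologicalSpace V] [IsTopologicalAddGroup V] {A B : Set V}
    (hA : IsBanachDisc k A) (hB : IsBanachDisc k B) : IsBanachDisc k (A + B) := by
  have h := (hA.prod hB).image (ContinuousLinearMap.fst k V V + ContinuousLinearMap.snd k V V)
  rwa [show A + B = _ from (Set.image_prod (· + ·)).symm]

end BanachDisc

section NuclearIdeal

variable {k : Type*} [NontriviallyNormedField k]
variable {V : Type*} [AddCommGroup V] [Module k V] [TopologicalSpace V]
variable {W : Type*} [AddCommGroup W] [Module k W] [TopologicalSpace W]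
variable {X : Type*} [AddCommGroup X] [Module k X] [TopologicalSpace X]

theorem IsNuclearMap.comp_left {f : V →L[k] W} (hf : IsNuclearMap f) (u : W →L[k] X) :
    IsNuclearMap (u ∘L f) := by
  obtain ⟨lam, l, y, B, hlam, hl, hB, hy, hsum⟩ := hf
  refine ⟨lam, l, fun n => u (y n), u '' B, hlam, hl, hB.image u,
    fun n => Set.mem_image_of_mem u (hy n), fun x => ?_⟩
  simpa [Function.comp_def] using (hsum x).map u u.continuous

theorem IsNuclearMap.comp_right {f : V →L[k] W} (hf : IsNuclearMap f) (u : X →L[k] V) :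
    IsNuclearMap (f ∘L u) := by
  obtain ⟨lam, l, y, B, hlam, hl, hB, hy, hsum⟩ := hf
  exact ⟨lam, fun n => l n ∘L u, y, B, hlam,
    fun x U hU => u.continuous.continuousAt.eventually (hl (u x) U hU), hB, hy,
    fun x => hsum (u x)⟩

theorem isNuclearMap_of_countable {ι : Type*} [Countable ι] {f : V →L[k] W} (lam : ι → k)
    (l : ι → V →L[k] k) (y : ι → W) (B : Set W) (hlam : Summable lam)
    (hl : Equicontinuous (fun i => (l i : V → k))) (hB : IsBanachDisc k B) (hy : ∀ i, y i ∈ B)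
    (hsum : ∀ x, HasSum (fun i => (lam i * l i x) • y i) (f x)) : IsNuclearMap f := by
  obtain ⟨e, he⟩ := exists_injective_nat ι
  have hout : ∀ n, n ∉ Set.range e → Function.extend e lam 0 n = 0 := fun n hn =>
    Function.extend_apply' _ _ _ hn
  refine ⟨Function.extend e lam 0, Function.extend e l 0, Function.extend e y 0, B, ?_, ?_, hB,
    fun n => ?_, fun x => ?_⟩
  · rw [← he.summable_iff hout]
    simpa [Function.comp_def, he.extend_apply] using hlam
  · intro x U hU
    filter_upwards [hl x U hU] with z hz n
    by_cases hn : ∃ i, e i = n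
    · obtain ⟨i, rfl⟩ := hn
      simpa [he.extend_apply] using hz i
    · simpa [Function.extend_apply' _ _ _ hn] using refl_mem_uniformity hU
  · by_cases hn : ∃ i, e i = n
    · obtain ⟨i, rfl⟩ := hn
      simpa [he.extend_apply] using hy i
    · simpa [Function.extend_apply' _ _ _ hn] using hB.disc.zero_mem
  · rw [← he.hasSum_iff (fun n hn => by simp [hout n hn])]
    simpa [Function.comp_def, he.extend_apply] using hsum x

theorem IsNuclearMap.add [IsTopologicalAddGroup W] {f g : V →L[k] W} (hf : IsNuclearMap f)
    (hg : IsNuclearMap g) : IsNuclearMap (f + g) := by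
  obtain ⟨lam, l, y, B, hlam, hl, hB, hy, hsum⟩ := hf
  obtain ⟨lam', l', y', B', hlam', hl', hB', hy', hsum'⟩ := hg
  refine isNuclearMap_of_countable (ι := ℕ ⊕ ℕ) (Sum.elim lam lam') (Sum.elim l l')
    (Sum.elim y y') (B + B') ?_ ?_ (hB.add hB') ?_ fun x => ?_
  · exact (HasSum.sum (f := Sum.elim lam lam') hlam.hasSum hlam'.hasSum).summable
  · intro x U hU
    filter_upwards [hl x U hU, hl' x U hU] with z hz hz'
    exact Sum.forall.2 ⟨hz, hz'⟩
  · refine Sum.forall.2 ⟨fun n => ?_, fun n => ?_⟩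
    · exact ⟨y n, hy n, 0, hB'.disc.zero_mem, by simp⟩
    · exact ⟨0, hB.disc.zero_mem, y' n, hy' n, by simp⟩
  · exact HasSum.sum (by simpa [Function.comp_def] using hsum x)
      (by simpa [Function.comp_def] using hsum' x)

end NuclearIdeal

section LocalBanach

variable {k : Type*} [NontriviallyNormedField k]
variable {E : Type*} [AddCommGroup E] [Module k E]

theorem norm_toLocalBanach (p : Seminorm k E) (x : E) : ‖toLocalBanach p x‖ = p x :=
  UniformSpace.Completion.norm_coe _

theorem denseRange_toLocalBanach (p : Seminorm k E) : DenseRange (toLocalBanach p) :=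
  UniformSpace.Completion.denseRange_coe (α := WithSeminorm p)

/-- The canonical map `toLocalBanach p` from `E` to the Banach space attached to `p`, as a linear
map. -/
def toLocalBanachₗ (p : Seminorm k E) : E →ₗ[k] LocalBanach p where
  toFun := toLocalBanach p
  map_add' x y := UniformSpace.Completion.coe_add (α := WithSeminorm p) x y
  map_smul' a x := UniformSpace.Completion.coe_smul (X := WithSeminorm p) a x

@[simp]
theorem toLocalBanachₗ_apply (p : Seminorm k E) (x : E) :
    toLocalBanachₗ p x = toLocalBanach p x := rfl

/-- The canonical map `toLocalBanach p` for a continuous seminorm `p`, as a continuous linear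
map. -/
def toLocalBanachL [TopologicalSpace E] [IsTopologicalAddGroup E] (p : Seminorm k E)
    (hp : Continuous p) : E →L[k] LocalBanach p where
  toLinearMap := toLocalBanachₗ p
  cont := by
    refine continuous_of_continuousAt_zero (toLocalBanachₗ p) ?_
    rw [ContinuousAt, map_zero, tendsto_zero_iff_norm_tendsto_zero]
    simpa [norm_toLocalBanach] using hp.tendsto 0

@[simp]
theorem toLocalBanachL_apply [TopologicalSpace E] [IsTopologicalAddGroup E] {p : Seminorm k E}
    (hp : Continuous p) (x : E) : toLocalBanachL p hp x = toLocalBanach p x := rfl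

theorem isConvexSeminorm_normSeminorm_localBanach {p : Seminorm k E}
    (hp : IsConvexSeminorm k p) : IsConvexSeminorm k (normSeminorm k (LocalBanach p)) := by
  intro hu x y
  simp only [coe_normSeminorm]
  induction x, y using (denseRange_toLocalBanach p).induction_on₂ with
  | hp => exact isClosed_le (by fun_prop) (by fun_prop)
  | h x y =>
    rw [← toLocalBanachₗ_apply, ← toLocalBanachₗ_apply, ← map_add]
    simpa only [toLocalBanachₗ_apply, norm_toLocalBanach] using hp hu x y

variable {W : Type*} [AddCommGroup W] [Module k W] [UniformSpace W] [IsUniformAddGroup W]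
  [ContinuousSMul k W] [CompleteSpace W] [T2Space W]

theorem exists_localBanach_extension {p : Seminorm k E} {f : E →ₗ[k] W}
    (hf : Bornology.IsVonNBounded k (f '' {x | p x < 1})) :
    ∃ g : LocalBanach p →L[k] W, ∀ x, g (toLocalBanach p x) = f x := by
  let f₀ : WithSeminorm p →L[k] W := LinearMap.clmOfExistsBoundedImage f
    ⟨Metric.ball 0 1, Metric.ball_mem_nhds _ one_pos, hf.subset <| Set.image_mono fun _ hx =>
      mem_ball_zero_iff.1 hx⟩
  exact ⟨f₀.extend UniformSpace.Completion.toComplL, f₀.extend_eq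
    UniformSpace.Completion.denseRange_coe (UniformSpace.Completion.isUniformInducing_coe _)⟩

theorem isNuclearMap_of_isNuclearSpace [TopologicalSpace E] [IsTopologicalAddGroup E]
    (hE : IsNuclearSpace k E) (hlc : IsLocallyConvex k E) (f : E →L[k] W) {U : Set E}
    (hU : U ∈ 𝓝 0) (hf : Bornology.IsVonNBounded k (f '' U)) : IsNuclearMap f := by
  obtain ⟨p, hpc, hp, hpU⟩ := hlc U hU
  obtain ⟨q, -, hq, -, T, hT, hTn⟩ := hE p hpc hp
  obtain ⟨g, hg⟩ := exists_localBanach_extension (f := (f : E →ₗ[k] W))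
    (hf.subset (Set.image_mono hpU))
  have hfactor : f = g ∘L T ∘L toLocalBanachL q hq := by
    ext x
    simp [hT, hg]
  rw [hfactor]
  exact (hTn.comp_right _).comp_left g

end LocalBanach

section StrongDual

variable {k : Type*} [NontriviallyNormedField k]
variable {E : Type*} [AddCommGroup E] [Module k E] [TopologicalSpace E]
variable {F : Type*} [AddCommGroup F] [Module k F] [TopologicalSpace F]

theorem polar_mem_nhds_zero {B : Set F} (hB : Bornology.IsVonNBounded k B) :
    StrongDual.polar k B ∈ 𝓝 (0 : StrongDual k F) := by
  filter_upwards [ContinuousLinearMap.eventually_nhds_zero_mapsTo hB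
    (Metric.closedBall_mem_nhds (0 : k) one_pos)] with φ hφ v hv
  simpa using hφ hv

theorem exists_polar_subset_of_mem_nhds_zero [ContinuousConstSMul k F] {N : Set (StrongDual k F)}
    (hN : N ∈ 𝓝 0) : ∃ B : Set F, Bornology.IsVonNBounded k B ∧ StrongDual.polar k B ⊆ N := by
  obtain ⟨⟨B, ε⟩, ⟨hB, hε⟩, hBN⟩ := (ContinuousLinearMap.hasBasis_nhds_zero_of_basis
    (σ := RingHom.id k) (E := F) (Metric.nhds_basis_ball (x := (0 : k)))).mem_iff.1 hN
  obtain ⟨d, hd⟩ := NormedField.exists_lt_norm k ε⁻¹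
  have hd0 : 0 < ‖d‖ := (inv_pos.2 hε).trans hd
  refine ⟨d • B, hB.image (d • ContinuousLinearMap.id k F), fun φ hφ => hBN fun v hv => ?_⟩
  have hφv : ‖d‖ * ‖φ v‖ ≤ 1 := by
    simpa using hφ (d • v) (Set.smul_mem_smul_set hv)
  rw [mem_ball_zero_iff]
  calc ‖φ v‖ ≤ ‖d‖⁻¹ := by rwa [← mul_one ‖d‖⁻¹, le_inv_mul_iff₀ hd0]
    _ < ε := inv_lt_of_inv_lt₀ hε hd

theorem isVonNBounded_polar {U : Set F} (hU : U ∈ 𝓝 0) :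
    Bornology.IsVonNBounded k (StrongDual.polar k U) := by
  refine ContinuousLinearMap.isVonNBounded_iff.2 fun S hS => ?_
  obtain ⟨c, hc⟩ := (hS hU).exists
  refine (NormedSpace.isVonNBounded_closedBall k k ‖c‖).subset ?_
  rintro _ ⟨φ, hφ, v, hv, rfl⟩
  obtain ⟨w, hw, rfl⟩ := hc hv
  simpa [norm_smul] using mul_le_of_le_one_right (norm_nonneg c) (hφ w hw)

theorem tendsto_apply_zero_of_barrelledSpace {G : Type*} [SeminormedAddCommGroup G]
    [NormedSpace k G] [IsTopologicalAddGroup F] [ContinuousSMul k F] [BarrelledSpace k F]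
    {φ : ℕ → F →L[k] G} {v : ℕ → F} (hφ : ∀ w, Tendsto (fun n => φ n w) atTop (𝓝 0))
    (hv : Tendsto v atTop (𝓝 0)) : Tendsto (fun n => φ n (v n)) atTop (𝓝 0) := by
  let _ : UniformSpace F := IsTopologicalAddGroup.rightUniformSpace F
  have : IsUniformAddGroup F := isUniformAddGroup_of_addCommGroup
  have hequi := (PolynormableSpace.banach_steinhaus fun w =>
    (hφ w).isVonNBounded_range k).equicontinuous
  rw [Metric.tendsto_nhds]
  intro ε hε
  filter_upwards [hv.eventually (hequi 0 _ (Metric.dist_mem_uniformity hε))] with n hn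
  simpa [dist_comm] using hn n

theorem exists_image_subset_polar [FirstCountableTopology E] [IsTopologicalAddGroup F]
    [ContinuousSMul k F] [FirstCountableTopology F] [BarrelledSpace k F]
    (f : E →L[k] StrongDual k F) :
    ∃ U ∈ 𝓝 (0 : E), ∃ U' ∈ 𝓝 (0 : F), f '' U ⊆ StrongDual.polar k U' := by
  obtain ⟨A, hA⟩ := (𝓝 (0 : E)).exists_antitone_basis
  obtain ⟨D, hD⟩ := (𝓝 (0 : F)).exists_antitone_basis
  suffices h : ∃ n, ∀ x ∈ A n, ∀ v ∈ D n, ‖f x v‖ ≤ 1 by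
    obtain ⟨n, hn⟩ := h
    exact ⟨A n, hA.mem n, D n, hD.mem n, Set.image_subset_iff.2 hn⟩
  by_contra! hlarge
  choose x hx v hv hxv using hlarge
  have hpointwise (w : F) : Tendsto (fun n => f (x n) w) atTop (𝓝 0) := by
    simpa [Function.comp_def] using
      (((continuous_eval_const w).comp f.continuous).tendsto 0).comp (hA.tendsto hx)
  have hzero := (tendsto_apply_zero_of_barrelledSpace hpointwise (hD.tendsto hv)).norm
  rw [norm_zero] at hzero
  obtain ⟨n, hn⟩ := (hzero.eventually_lt_const one_pos).exists
  exact (hxv n).not_gt hn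

theorem exists_isVonNBounded_iUnion_smul [FirstCountableTopology F] [ContinuousSMul k F]
    {B : ℕ → Set F} (hB : ∀ m, Bornology.IsVonNBounded k (B m)) :
    ∃ c : ℕ → k, (∀ m, c m ≠ 0) ∧ Bornology.IsVonNBounded k (⋃ m, c m • B m) := by
  obtain ⟨D, hD⟩ := (𝓝 (0 : F)).exists_antitone_basis
  choose c hc hcB using fun m =>
    ((Bornology.eventually_ne_cobounded (0 : k)).and (hB m (hD.mem m))).exists
  have hcD (m : ℕ) : (c m)⁻¹ • B m ⊆ D m :=
    (Set.smul_set_subset_iff₀ (inv_ne_zero (hc m))).2 (by simpa using hcB m)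
  refine ⟨fun m => (c m)⁻¹, fun m => inv_ne_zero (hc m), ?_⟩
  refine (nhds_basis_balanced k F).isVonNBounded_iff.2 fun U hU => ?_
  obtain ⟨M, hM⟩ := hD.mem_iff.1 hU.1
  have hsub : (⋃ m, (c m)⁻¹ • B m) ⊆ (⋃ m ∈ Finset.range M, (c m)⁻¹ • B m) ∪ U := by
    refine Set.iUnion_subset fun m => ?_
    rcases lt_or_ge m M with h | h
    · exact Set.subset_union_of_subset_left
        (Set.subset_biUnion_of_mem (u := fun m => (c m)⁻¹ • B m) (Finset.mem_range.2 h)) U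
    · exact Set.subset_union_of_subset_right ((hcD m).trans ((hD.antitone h).trans hM)) _
  refine Absorbs.mono_right (Absorbs.union ?_ hU.2.absorbs_self) hsub
  rw [absorbs_biUnion_finset]
  exact fun m _ => ((hB m).image ((c m)⁻¹ • ContinuousLinearMap.id k F)) hU.1

theorem exists_isVonNBounded_image_of_strongDual [FirstCountableTopology F] [ContinuousSMul k F]
    [FirstCountableTopology E] [ContinuousSMul k E] (f : StrongDual k F →L[k] E) :
    ∃ U ∈ 𝓝 (0 : StrongDual k F), Bornology.IsVonNBounded k (f '' U) := by
  obtain ⟨A, hA⟩ := (𝓝 (0 : E)).exists_antitone_basis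
  choose B hB hBA using fun m => exists_polar_subset_of_mem_nhds_zero
    (f.continuous.continuousAt.preimage_mem_nhds (by simpa using hA.mem m))
  obtain ⟨c, hc, hcB⟩ := exists_isVonNBounded_iUnion_smul hB
  refine ⟨_, polar_mem_nhds_zero hcB, ?_⟩
  refine (nhds_basis_balanced k E).isVonNBounded_iff.2 fun U hU => ?_
  obtain ⟨m, hm⟩ := hA.mem_iff.1 hU.1
  filter_upwards [eventually_cobounded_le_norm ‖(c m)⁻¹‖] with a ha
  refine subset_trans ?_ (hU.2.smul_mono ha)
  rintro _ ⟨φ, hφ, rfl⟩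
  have hmem : c m • φ ∈ StrongDual.polar k (B m) := fun v hv => by
    simpa using hφ (c m • v) (Set.mem_iUnion.2 ⟨m, v, hv, rfl⟩)
  exact ⟨f (c m • φ), hm (hBA m hmem), by simp [smul_smul, hc m]⟩

end StrongDual

section Coefficients

variable (k : Type*) [inst : NontriviallyNormedField k]

/-- The norm of `k` is non-archimedean, or it is the usual one on `ℝ` or `ℂ`. These are the normed
fields over which unconditional convergence of scalar series is convergence in the sup norm, resp.
the `ℓ¹`-norm, of the coefficients. -/
def IsUltrametricOrRCLike : Prop :=
  IsUltrametricDist k ∨ ∃ r : RCLike k, r.toDenselyNormedField.toNontriviallyNormedField = inst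

variable {k} {ι κ : Type*}

theorem IsUltrametricOrRCLike.summable_norm (hk : IsUltrametricOrRCLike k)
    (hu : ¬ IsUltrametricDist k) {c : ι → k} (hc : Summable c) : Summable fun i => ‖c i‖ := by
  obtain h | ⟨r, rfl⟩ := hk
  · exact absurd h hu
  · exact hc.norm

open Classical in
/-- The norm in which the coefficients of nuclear expansions are measured: the maximum of the
absolute values if `k` is non-archimedean, their sum otherwise. It is the norm that controls the
values of convex seminorms on linear combinations. -/
def coeffNorm (s : Finset ι) (c : ι → k) : ℝ :=
  if IsUltrametricDist k then ((s.sup fun i => ‖c i‖₊ : NNReal) : ℝ) else ∑ i ∈ s, ‖c i‖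

theorem coeffNorm_of_isUltrametricDist (hu : IsUltrametricDist k) (s : Finset ι) (c : ι → k) :
    coeffNorm s c = (s.sup fun i => ‖c i‖₊ : NNReal) :=
  if_pos hu

theorem coeffNorm_of_not_isUltrametricDist (hu : ¬ IsUltrametricDist k) (s : Finset ι)
    (c : ι → k) : coeffNorm s c = ∑ i ∈ s, ‖c i‖ :=
  if_neg hu

theorem coeffNorm_nonneg (s : Finset ι) (c : ι → k) : 0 ≤ coeffNorm s c := by
  unfold coeffNorm
  split_ifs
  · exact NNReal.coe_nonneg _
  · exact Finset.sum_nonneg fun _ _ => norm_nonneg _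

theorem norm_le_coeffNorm {s : Finset ι} {i : ι} (hi : i ∈ s) (c : ι → k) :
    ‖c i‖ ≤ coeffNorm s c := by
  unfold coeffNorm
  split_ifs
  · exact_mod_cast Finset.le_sup (f := fun i => ‖c i‖₊) hi
  · exact Finset.single_le_sum (f := fun i => ‖c i‖) (fun _ _ => norm_nonneg _) hi

theorem coeffNorm_le_of_isUltrametricDist (hu : IsUltrametricDist k) {s : Finset ι} {c : ι → k}
    {C : ℝ} (hC : 0 ≤ C) (h : ∀ i ∈ s, ‖c i‖ ≤ C) : coeffNorm s c ≤ C := by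
  lift C to NNReal using hC
  rw [coeffNorm_of_isUltrametricDist hu]
  exact NNReal.coe_le_coe.2 (Finset.sup_le h)

theorem coeffNorm_le_sum_norm (s : Finset ι) (c : ι → k) : coeffNorm s c ≤ ∑ i ∈ s, ‖c i‖ := by
  by_cases hu : IsUltrametricDist k
  · exact coeffNorm_le_of_isUltrametricDist hu (Finset.sum_nonneg fun _ _ => norm_nonneg _)
      fun i hi => Finset.single_le_sum (f := fun i => ‖c i‖) (fun _ _ => norm_nonneg _) hi
  · exact (coeffNorm_of_not_isUltrametricDist hu s c).le

theorem coeffNorm_const_mul (s : Finset ι) (a : k) (c : ι → k) :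
    coeffNorm s (fun i => a * c i) = ‖a‖ * coeffNorm s c := by
  unfold coeffNorm
  split_ifs
  · simp only [nnnorm_mul, ← NNReal.mul_finset_sup, NNReal.coe_mul, coe_nnnorm]
  · simp only [norm_mul, Finset.mul_sum]

theorem coeffNorm_univ_coe (s : Finset ι) (c : ι → k) :
    coeffNorm Finset.univ (fun i : s => c i) = coeffNorm s c := by
  unfold coeffNorm
  split_ifs
  · rw [Finset.univ_eq_attach, Finset.sup_attach s fun i => ‖c i‖₊]
  · exact Finset.sum_coe_sort s fun i => ‖c i‖

theorem coeffNorm_univ_sumElim_le [Fintype ι] [Fintype κ] (c : ι → k) (d : κ → k) :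
    coeffNorm Finset.univ (Sum.elim c d) ≤
      coeffNorm Finset.univ c + coeffNorm Finset.univ d := by
  by_cases hu : IsUltrametricDist k
  · refine coeffNorm_le_of_isUltrametricDist hu
      (add_nonneg (coeffNorm_nonneg _ _) (coeffNorm_nonneg _ _)) ?_
    rintro (i | j) -
    · exact (norm_le_coeffNorm (Finset.mem_univ i) c).trans
        (le_add_of_nonneg_right (coeffNorm_nonneg _ _))
    · exact (norm_le_coeffNorm (Finset.mem_univ j) d).trans
        (le_add_of_nonneg_left (coeffNorm_nonneg _ _))
  · simp [coeffNorm_of_not_isUltrametricDist hu]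

theorem IsConvexSeminorm.sum_le {V : Type*} [AddCommGroup V] [Module k V] {p : Seminorm k V}
    (hp : IsConvexSeminorm k p) {s : Finset ι} (c : ι → k) {v : ι → V} {D : ℝ} (hD : 0 ≤ D)
    (hv : ∀ i ∈ s, p (v i) ≤ D) : p (∑ i ∈ s, c i • v i) ≤ coeffNorm s c * D := by
  by_cases hu : IsUltrametricDist k
  · refine Finset.sum_induction _ (fun w => p w ≤ coeffNorm s c * D)
      (fun x y hx hy => (hp hu x y).trans (max_le hx hy))
      (by simpa using mul_nonneg (coeffNorm_nonneg s c) hD) fun i hi => ?_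
    rw [map_smul_eq_mul]
    exact mul_le_mul (norm_le_coeffNorm hi c) (hv i hi) (apply_nonneg _ _) (coeffNorm_nonneg s c)
  · rw [coeffNorm_of_not_isUltrametricDist hu]
    calc p (∑ i ∈ s, c i • v i) ≤ ∑ i ∈ s, p (c i • v i) :=
          Finset.le_sum_of_subadditive p (map_zero p).le (map_add_le_add p) _ _
      _ = ∑ i ∈ s, ‖c i‖ * p (v i) := by simp only [map_smul_eq_mul]
      _ ≤ ∑ i ∈ s, ‖c i‖ * D := by gcongr with i hi; exact hv i hi
      _ = (∑ i ∈ s, ‖c i‖) * D := (Finset.sum_mul _ _ _).symm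

theorem IsUltrametricOrRCLike.exists_coeffNorm_le (hk : IsUltrametricOrRCLike k) {c : ι → k}
    (hc : Summable c) : ∃ C, ∀ s : Finset ι, coeffNorm s c ≤ C := by
  by_cases hu : IsUltrametricDist k
  · obtain ⟨C, hC⟩ := hc.tendsto_cofinite_zero.norm.bddAbove_range_of_cofinite
    exact ⟨max C 0, fun s => coeffNorm_le_of_isUltrametricDist hu (le_max_right _ _) fun i _ =>
      (hC ⟨i, rfl⟩).trans (le_max_left _ _)⟩
  · refine ⟨∑' i, ‖c i‖, fun s => ?_⟩
    rw [coeffNorm_of_not_isUltrametricDist hu]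
    exact (hk.summable_norm hu hc).sum_le_tsum s fun _ _ => norm_nonneg _

theorem IsUltrametricOrRCLike.exists_coeffNorm_le_of_disjoint (hk : IsUltrametricOrRCLike k)
    {c : ι → k} (hc : Summable c) {ε : ℝ} (hε : 0 < ε) :
    ∃ s : Finset ι, ∀ t, Disjoint t s → coeffNorm t c ≤ ε := by
  by_cases hu : IsUltrametricDist k
  · have hsmall := hc.tendsto_cofinite_zero.norm.eventually_le_const (by simpa using hε)
    refine ⟨(Filter.eventually_cofinite.1 hsmall).toFinset, fun t ht =>
      coeffNorm_le_of_isUltrametricDist hu hε.le fun i hi => ?_⟩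
    by_contra hlarge
    exact Finset.disjoint_left.1 ht hi (by simpa using hlarge)
  · obtain ⟨s, hs⟩ := summable_iff_vanishing_norm.1 (hk.summable_norm hu hc) ε hε
    refine ⟨s, fun t ht => ?_⟩
    rw [coeffNorm_of_not_isUltrametricDist hu]
    exact (le_abs_self _).trans (hs t ht).le

theorem summable_of_coeffNorm_sigma_le [CompleteSpace k] {κ : ℕ → Type*} [∀ m, Fintype (κ m)]
    {c : (Σ m, κ m) → k} {a : ℕ → ℝ} (ha : Summable a)
    (hc : ∀ m, coeffNorm Finset.univ (fun i : κ m => c ⟨m, i⟩) ≤ a m) : Summable c := by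
  by_cases hu : IsUltrametricDist k
  · refine NonarchimedeanAddGroup.summable_of_tendsto_cofinite_zero ?_
    refine Metric.tendsto_nhds.2 fun ε hε => ?_
    have hlarge := Filter.eventually_cofinite.1 (ha.tendsto_cofinite_zero.eventually_lt_const hε)
    refine Filter.eventually_cofinite.2
      ((hlarge.toFinset.sigma fun m => (Finset.univ : Finset (κ m))).finite_toSet.subset ?_)
    rintro ⟨m, i⟩ hi
    have hm : ¬a m < ε := fun hm => hi <| by
      rw [dist_zero_right]
      exact ((norm_le_coeffNorm (Finset.mem_univ i) _).trans (hc m)).trans_lt hm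
    simpa using hm
  · refine Summable.of_norm ((summable_sigma_of_nonneg fun _ => norm_nonneg _).2
      ⟨fun m => (hasSum_fintype _).summable, ?_⟩)
    refine Summable.of_nonneg_of_le (fun m => tsum_nonneg fun _ => norm_nonneg _) (fun m => ?_) ha
    rw [tsum_fintype, ← coeffNorm_of_not_isUltrametricDist hu]
    exact hc m

theorem IsUltrametricOrRCLike.summable_smul (hk : IsUltrametricOrRCLike k) {V : Type*}
    [AddCommGroup V] [Module k V] [UniformSpace V] [IsUniformAddGroup V] [CompleteSpace V]
    (hV : IsLocallyConvex k V) {c : ι → k} (hc : Summable c) {v : ι → V}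
    (hv : ∀ p : Seminorm k V, IsConvexSeminorm k p → Continuous p → ∃ D, ∀ i, p (v i) ≤ D) :
    Summable fun i => c i • v i := by
  refine summable_iff_vanishing.2 fun U hU => ?_
  obtain ⟨p, hpc, hp, hpU⟩ := hV U hU
  obtain ⟨D, hD⟩ := hv p hpc hp
  obtain ⟨s, hs⟩ := hk.exists_coeffNorm_le_of_disjoint hc
    (show 0 < (2 * (|D| + 1))⁻¹ by positivity)
  refine ⟨s, fun t ht => hpU ?_⟩
  calc p (∑ i ∈ t, c i • v i) ≤ coeffNorm t c * (|D| + 1) :=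
        hpc.sum_le c (by positivity) fun i _ => by linarith [hD i, le_abs_self D]
    _ ≤ (2 * (|D| + 1))⁻¹ * (|D| + 1) := by gcongr; exact hs t ht
    _ < 1 := by field_simp; norm_num

end Coefficients

section FiniteExpansion

variable {k : Type*} [NontriviallyNormedField k]
variable {E : Type*} [AddCommGroup E] [Module k E] [TopologicalSpace E]
variable {L : Type*} [AddCommGroup L] [Module k L] [TopologicalSpace L]

/-- `h` is of finite rank, given by functionals in the polar of `U`. -/
def HasFiniteRankOn (U : Set E) (h : E →L[k] L) : Prop :=
  ∃ (ι : Type) (_ : Fintype ι) (x : ι → E →L[k] k) (z : ι → L),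
    (∀ i, x i ∈ StrongDual.polar k U) ∧ ∀ e, h e = ∑ i, x i e • z i

/-- `h` has a finite nuclear expansion with coefficients of norm at most `C`, functionals in the
polar of `U`, and vectors in the unit ball of `p`. -/
def HasFiniteExpansion (U : Set E) (p : Seminorm k L) (C : ℝ) (h : E →L[k] L) : Prop :=
  ∃ (ι : Type) (_ : Fintype ι) (c : ι → k) (x : ι → E →L[k] k) (y : ι → L),
    coeffNorm Finset.univ c ≤ C ∧ (∀ i, x i ∈ StrongDual.polar k U) ∧ (∀ i, p (y i) ≤ 1) ∧
    ∀ e, h e = ∑ i, (c i * x i e) • y i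

/-- Measured by `p`, the identity of `L` is, up to errors small relative to `q`, of finite rank; the
bound `Λ` on the nuclear expansions of the finite-rank maps does not depend on the error. -/
def IsFiniteRankApprox (p q : Seminorm k L) (Λ : ℝ) : Prop :=
  ∀ ε > 0, ∃ A : L →L[k] L, HasFiniteExpansion {z | q z ≤ 1} p Λ A ∧
    ∀ z, p (z - A z) ≤ ε * q z

variable {U : Set E} {p q : Seminorm k L} {C D Λ : ℝ} {f g h : E →L[k] L}

theorem HasFiniteExpansion.hasFiniteRankOn (hh : HasFiniteExpansion U p C h) :
    HasFiniteRankOn U h := by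
  obtain ⟨ι, _, c, x, y, -, hx, -, hsum⟩ := hh
  exact ⟨ι, inferInstance, x, fun i => c i • y i, hx, fun e => by
    simp only [hsum e, smul_smul, mul_comm]⟩

theorem HasFiniteExpansion.mono (hh : HasFiniteExpansion U p C h) {p' : Seminorm k L}
    (hp : p' ≤ p) {C' : ℝ} (hC : C ≤ C') : HasFiniteExpansion U p' C' h := by
  obtain ⟨ι, _, c, x, y, hc, hx, hy, hsum⟩ := hh
  exact ⟨ι, inferInstance, c, x, y, hc.trans hC, hx, fun i => (hp _).trans (hy i), hsum⟩

theorem HasFiniteRankOn.sub [IsTopologicalAddGroup L] (hg : HasFiniteRankOn U g)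
    (hh : HasFiniteRankOn U h) : HasFiniteRankOn U (g - h) := by
  obtain ⟨ι, _, x, z, hx, hsum⟩ := hg
  obtain ⟨κ, _, x', z', hx', hsum'⟩ := hh
  refine ⟨ι ⊕ κ, inferInstance, Sum.elim x x', Sum.elim z (-z'), Sum.forall.2 ⟨hx, hx'⟩,
    fun e => ?_⟩
  simp [hsum e, hsum' e, sub_eq_add_neg]

theorem HasFiniteExpansion.add [IsTopologicalAddGroup L] (hg : HasFiniteExpansion U p C g)
    (hh : HasFiniteExpansion U p D h) : HasFiniteExpansion U p (C + D) (g + h) := by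
  obtain ⟨ι, _, c, x, y, hc, hx, hy, hsum⟩ := hg
  obtain ⟨κ, _, c', x', y', hc', hx', hy', hsum'⟩ := hh
  refine ⟨ι ⊕ κ, inferInstance, Sum.elim c c', Sum.elim x x', Sum.elim y y',
    (coeffNorm_univ_sumElim_le c c').trans (add_le_add hc hc'), Sum.forall.2 ⟨hx, hx'⟩,
    Sum.forall.2 ⟨hy, hy'⟩, fun e => ?_⟩
  simp [hsum e, hsum' e]

theorem HasFiniteExpansion.comp {A : L →L[k] L} (hA : HasFiniteExpansion {z | q z ≤ 1} p Λ A)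
    {μ : k} (hμ : μ ≠ 0) (hf : ∀ e ∈ U, q (f e) ≤ ‖μ‖) :
    HasFiniteExpansion U p (‖μ‖ * Λ) (A ∘L f) := by
  obtain ⟨ι, _, c, x, y, hc, hx, hy, hsum⟩ := hA
  refine ⟨ι, inferInstance, fun i => μ * c i, fun i => μ⁻¹ • (x i ∘L f), y, ?_, fun i e he => ?_,
    hy, fun e => ?_⟩
  · rw [coeffNorm_const_mul]
    gcongr
  · have hball : q (μ⁻¹ • f e) ≤ 1 := by
      rw [map_smul_eq_mul, norm_inv, inv_mul_le_iff₀ (norm_pos_iff.2 hμ), mul_one]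
      exact hf e he
    simpa using hx i _ hball
  · simp only [ContinuousLinearMap.comp_apply, hsum, smul_apply, smul_eq_mul]
    refine Finset.sum_congr rfl fun i _ => ?_
    congr 1
    field_simp

theorem hasFiniteExpansion_of_seminorm_le {ι : Type} [Fintype ι] {x : ι → E →L[k] k} {w : ι → L}
    (hx : ∀ i, x i ∈ StrongDual.polar k U) {t : k} (ht : t ≠ 0) (hw : ∀ i, p (w i) ≤ ‖t‖)
    (hsum : ∀ e, h e = ∑ i, x i e • w i) :
    HasFiniteExpansion U p (Fintype.card ι * ‖t‖) h := by
  refine ⟨ι, inferInstance, fun _ => t, x, fun i => t⁻¹ • w i, ?_, hx, fun i => ?_, fun e => ?_⟩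
  · simpa using coeffNorm_le_sum_norm Finset.univ fun _ : ι => t
  · rw [map_smul_eq_mul, norm_inv, inv_mul_le_iff₀ (norm_pos_iff.2 ht), mul_one]
    exact hw i
  · rw [hsum e]
    refine Finset.sum_congr rfl fun i _ => ?_
    rw [smul_smul]
    congr 1
    field_simp

theorem IsFiniteRankApprox.mono (hA : IsFiniteRankApprox p q Λ) {p' : Seminorm k L}
    (hp : p' ≤ p) : IsFiniteRankApprox p' q Λ := fun ε hε => by
  obtain ⟨A, hAexp, hAerr⟩ := hA ε hε
  exact ⟨A, hAexp.mono hp le_rfl, fun z => (hp _).trans (hAerr z)⟩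

theorem IsFiniteRankApprox.exists_hasFiniteExpansion (hA : IsFiniteRankApprox p q Λ)
    (hf : ∀ e ∈ U, q (f e) ≤ D) {ε : ℝ} (hε : 0 < ε) :
    ∃ (g : E →L[k] L) (C : ℝ), HasFiniteExpansion U p C g ∧ ∀ e ∈ U, p (f e - g e) ≤ ε := by
  obtain ⟨μ, hμ⟩ := NormedField.exists_lt_norm k |D|
  have hμ' : 0 < ‖μ‖ := (abs_nonneg D).trans_lt hμ
  have hfμ : ∀ e ∈ U, q (f e) ≤ ‖μ‖ := fun e he =>
    (hf e he).trans ((le_abs_self D).trans hμ.le)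
  obtain ⟨A, hAexp, hAerr⟩ := hA (ε / ‖μ‖) (by positivity)
  refine ⟨A ∘L f, _, hAexp.comp (norm_pos_iff.1 hμ') hfμ, fun e he => ?_⟩
  calc p (f e - A (f e)) ≤ ε / ‖μ‖ * q (f e) := hAerr (f e)
    _ ≤ ε / ‖μ‖ * ‖μ‖ := by gcongr; exact hfμ e he
    _ = ε := div_mul_cancel₀ _ hμ'.ne'

/- In `h = A ∘ h + (1 - A) ∘ h` the first summand inherits the expansion of `A`, and the second,
which is of the same rank as `h`, is made negligible by the choice of `A`. -/
theorem IsFiniteRankApprox.hasFiniteExpansion [IsTopologicalAddGroup L]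
    (hA : IsFiniteRankApprox p q Λ) (hh : HasFiniteRankOn U h) {μ : k} (hμ : μ ≠ 0)
    (hle : ∀ e ∈ U, q (h e) ≤ ‖μ‖) (hC : ‖μ‖ * Λ < C) : HasFiniteExpansion U p C h := by
  obtain ⟨ι, _, x, z, hx, hsum⟩ := hh
  obtain ⟨t, ht, htC⟩ := NormedField.exists_norm_lt k
    (r := (C - ‖μ‖ * Λ) / (Fintype.card ι + 1)) (by have := sub_pos.2 hC; positivity)
  have hS : 0 ≤ ∑ i, q (z i) := Finset.sum_nonneg fun _ _ => apply_nonneg _ _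
  obtain ⟨A, hAexp, hAerr⟩ := hA (‖t‖ / (1 + ∑ i, q (z i))) (by positivity)
  have hsmall (i : ι) : p (z i - A (z i)) ≤ ‖t‖ := by
    have hzi : q (z i) ≤ ∑ i, q (z i) :=
      Finset.single_le_sum (fun i _ => apply_nonneg q (z i)) (Finset.mem_univ i)
    calc p (z i - A (z i)) ≤ ‖t‖ / (1 + ∑ i, q (z i)) * q (z i) := hAerr (z i)
      _ ≤ ‖t‖ / (1 + ∑ i, q (z i)) * (1 + ∑ i, q (z i)) := by gcongr; linarith
      _ = ‖t‖ := div_mul_cancel₀ _ (by positivity)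
  have hrest : HasFiniteExpansion U p (Fintype.card ι * ‖t‖) (h - A ∘L h) :=
    hasFiniteExpansion_of_seminorm_le hx (norm_pos_iff.1 ht) hsmall fun e => by
      simp [hsum e, smul_sub]
  have hdecomp := (hAexp.comp hμ hle).add hrest
  rw [add_sub_cancel] at hdecomp
  refine hdecomp.mono le_rfl ?_
  rw [lt_div_iff₀ (by positivity)] at htC
  linarith

end FiniteExpansion

section Approximation

variable {k : Type*} [NontriviallyNormedField k]
variable {E : Type*} [NormedAddCommGroup E] [NormedSpace k E]
variable {F : Type*} [NormedAddCommGroup F] [NormedSpace k F]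

theorem IsNuclearMap.exists_normalized {f : E →L[k] F} (hf : IsNuclearMap f) :
    ∃ (c : ℕ → k) (x : ℕ → E →L[k] k) (y : ℕ → F), Summable c ∧ (∀ n e, ‖x n e‖ ≤ ‖e‖) ∧
      (∀ n, ‖y n‖ < 1) ∧ ∀ e, HasSum (fun n => c n • x n e • y n) (f e) := by
  obtain ⟨c, x, y, B, hc, hx, hB, hy, hsum⟩ := hf
  obtain ⟨R, hR⟩ : ∃ R, ∀ v ∈ B, ‖v‖ ≤ R :=
    isBounded_iff_forall_norm_le.1 ((NormedSpace.isVonNBounded_iff k).1 hB.bounded)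
  obtain ⟨M, hM⟩ : ∃ M, ∀ n e, ‖x n e‖ ≤ M * ‖e‖ :=
    ((NormedSpace.equicontinuous_TFAE x).out 1 3).1 hx
  obtain ⟨a, ha⟩ := NormedField.exists_lt_norm k |M|
  obtain ⟨b, hb⟩ := NormedField.exists_lt_norm k |R|
  have ha' : 0 < ‖a‖ := (abs_nonneg M).trans_lt ha
  have hb' : 0 < ‖b‖ := (abs_nonneg R).trans_lt hb
  have ha0 : a ≠ 0 := norm_pos_iff.1 ha'
  have hb0 : b ≠ 0 := norm_pos_iff.1 hb'
  refine ⟨fun n => a * b * c n, fun n => a⁻¹ • x n, fun n => b⁻¹ • y n, hc.mul_left _,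
    fun n e => ?_, fun n => ?_, fun e => ?_⟩
  · rw [smul_apply, norm_smul, norm_inv, inv_mul_le_iff₀ ha']
    exact (hM n e).trans (by gcongr; exact (le_abs_self M).trans ha.le)
  · rw [norm_smul, norm_inv, inv_mul_lt_iff₀ hb', mul_one]
    exact ((hR _ (hy n)).trans (le_abs_self R)).trans_lt hb
  · convert hsum e using 2 with n
    simp only [smul_apply, smul_smul, smul_eq_mul]
    congr 1
    field_simp

theorem norm_sub_sum_le_of_hasSum {ι : Type*} (hF : IsConvexSeminorm k (normSeminorm k F))
    {c : ι → k} {v : ι → F} {a : F} (ha : HasSum (fun i => c i • v i) a) {s : Finset ι} {ε D : ℝ}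
    (hs : ∀ t, Disjoint t s → coeffNorm t c ≤ ε) (hD : 0 ≤ D) (hv : ∀ i, ‖v i‖ ≤ D) :
    ‖a - ∑ i ∈ s, c i • v i‖ ≤ ε * D := by
  classical
  refine le_of_tendsto (ha.sub_const (∑ i ∈ s, c i • v i)).norm ?_
  filter_upwards [eventually_ge_atTop s] with t ht
  rw [← Finset.sum_sdiff ht, add_sub_cancel_right]
  exact (hF.sum_le c hD fun i _ => hv i).trans
    (mul_le_mul_of_nonneg_right (hs _ Finset.sdiff_disjoint) hD)

theorem IsNuclearMap.exists_finite_approx (hk : IsUltrametricOrRCLike k)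
    (hF : IsConvexSeminorm k (normSeminorm k F)) {f : E →L[k] F} (hf : IsNuclearMap f) {S : Set F}
    (hS : Dense S) :
    ∃ Λ, ∀ ε > 0, ∃ (s : Finset ℕ) (c : ℕ → k) (x : ℕ → E →L[k] k) (y : ℕ → F),
      coeffNorm s c ≤ Λ ∧ (∀ n e, ‖x n e‖ ≤ ‖e‖) ∧ (∀ n, y n ∈ S) ∧ (∀ n, ‖y n‖ ≤ 1) ∧
      ∀ e, ‖f e - ∑ n ∈ s, c n • x n e • y n‖ ≤ ε * ‖e‖ := by
  obtain ⟨c, x, y, hc, hx, hy, hsum⟩ := hf.exists_normalized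
  obtain ⟨Λ, hΛ⟩ := hk.exists_coeffNorm_le hc
  have hΛ0 : 0 ≤ Λ := (coeffNorm_nonneg ∅ c).trans (hΛ ∅)
  refine ⟨Λ, fun ε hε => ?_⟩
  obtain ⟨s, hs⟩ := hk.exists_coeffNorm_le_of_disjoint hc (half_pos hε)
  obtain ⟨δ, hδ, hΛδ⟩ : ∃ δ > 0, Λ * δ ≤ ε / 2 :=
    ⟨ε / 2 / (Λ + 1), by positivity, by rw [← mul_div_assoc, div_le_iff₀] <;> nlinarith⟩
  have happrox (n : ℕ) : ∃ y' ∈ S, ‖y' - y n‖ < δ ∧ ‖y'‖ < 1 := by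
    obtain ⟨y', hy'S, hy'n, hy'0⟩ := hS.exists_mem_open
      (Metric.isOpen_ball.inter Metric.isOpen_ball)
      ⟨y n, Metric.mem_ball_self hδ, mem_ball_zero_iff.2 (hy n)⟩
    exact ⟨y', hy'S, mem_ball_iff_norm.1 hy'n, mem_ball_zero_iff.1 hy'0⟩
  choose y' hy'S hy' hy'1 using happrox
  refine ⟨s, c, x, y', hΛ s, hx, hy'S, fun n => (hy'1 n).le, fun e => ?_⟩
  have htail : ‖f e - ∑ n ∈ s, c n • x n e • y n‖ ≤ ε / 2 * ‖e‖ :=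
    norm_sub_sum_le_of_hasSum hF (hsum e) hs (norm_nonneg e) fun n => by
      rw [norm_smul, ← mul_one ‖e‖]
      exact mul_le_mul (hx n e) (hy n).le (norm_nonneg _) (norm_nonneg _)
  have hperturb : ‖∑ n ∈ s, c n • x n e • (y' n - y n)‖ ≤ coeffNorm s c * (‖e‖ * δ) :=
    hF.sum_le c (by positivity) fun n _ => by
      rw [coe_normSeminorm, norm_smul]
      exact mul_le_mul (hx n e) (hy' n).le (norm_nonneg _) (norm_nonneg _)
  calc ‖f e - ∑ n ∈ s, c n • x n e • y' n‖
      = ‖(f e - ∑ n ∈ s, c n • x n e • y n) - ∑ n ∈ s, c n • x n e • (y' n - y n)‖ := by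
        simp only [smul_sub, Finset.sum_sub_distrib]
        abel_nf
    _ ≤ ε / 2 * ‖e‖ + coeffNorm s c * (‖e‖ * δ) := norm_sub_le_of_le htail hperturb
    _ ≤ ε / 2 * ‖e‖ + Λ * (‖e‖ * δ) := by gcongr; exact hΛ s
    _ = ε / 2 * ‖e‖ + Λ * δ * ‖e‖ := by ring
    _ ≤ ε / 2 * ‖e‖ + ε / 2 * ‖e‖ := by gcongr
    _ = ε * ‖e‖ := by ring

variable {L : Type*} [AddCommGroup L] [Module k L] [TopologicalSpace L] [IsTopologicalAddGroup L]
  [ContinuousSMul k L]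

theorem IsNuclearSpace.exists_isFiniteRankApprox (hk : IsUltrametricOrRCLike k)
    (hL : IsNuclearSpace k L) {p : Seminorm k L} (hpc : IsConvexSeminorm k p)
    (hp : Continuous p) :
    ∃ q : Seminorm k L, IsConvexSeminorm k q ∧ Continuous q ∧ p ≤ q ∧
      ∃ Λ, IsFiniteRankApprox p q Λ := by
  obtain ⟨q, hqc, hq, hpq, T, hT, hTn⟩ := hL p hpc hp
  obtain ⟨Λ, hΛ⟩ := hTn.exists_finite_approx hk (isConvexSeminorm_normSeminorm_localBanach hpc)
    (denseRange_toLocalBanach p)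
  refine ⟨q, hqc, hq, hpq, Λ, fun ε hε => ?_⟩
  obtain ⟨s, c, x, y, hc, hx, hyS, hy, happrox⟩ := hΛ ε hε
  choose z hz using hyS
  refine ⟨∑ n ∈ s, (c n • (x n ∘L toLocalBanachL q hq)).smulRight (z n),
    ⟨s, inferInstance, fun n => c n, fun n => x n ∘L toLocalBanachL q hq, fun n => z n,
      (coeffNorm_univ_coe s c).trans_le hc, fun n e he => ?_, fun n => ?_, fun e => ?_⟩,
    fun e => ?_⟩
  · simpa using (hx n _).trans ((norm_toLocalBanach q e).trans_le he)
  · simpa [← norm_toLocalBanach, hz] using hy n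
  · rw [Finset.sum_coe_sort s fun n => (c n * (x n ∘L toLocalBanachL q hq) e) • z n]
    simp
  · have herr : toLocalBanach p (e - ∑ n ∈ s, (c n * x n (toLocalBanach q e)) • z n) =
        T (toLocalBanach q e) - ∑ n ∈ s, c n • x n (toLocalBanach q e) • y n := by
      rw [hT]
      simp [← toLocalBanachₗ_apply, ← hz, mul_smul]
    simpa [← norm_toLocalBanach, herr] using happrox (toLocalBanach q e)

theorem IsConvexSeminorm.sup {V : Type*} [AddCommGroup V] [Module k V] {p q : Seminorm k V}
    (hp : IsConvexSeminorm k p) (hq : IsConvexSeminorm k q) : IsConvexSeminorm k (p ⊔ q) :=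
  fun hu x y => by
    simp only [Seminorm.sup_apply]
    exact (max_le_max (hp hu x y) (hq hu x y)).trans (max_max_max_comm _ _ _ _).le

theorem withSeminorms_of_continuous {ι V : Type*} [Nonempty ι] [AddCommGroup V] [Module k V]
    [TopologicalSpace V] [IsTopologicalAddGroup V] {p : ι → Seminorm k V}
    (hp : ∀ i, Continuous (p i)) (hbasis : ∀ U ∈ 𝓝 (0 : V), ∃ i, {x | p i x < 1} ⊆ U) :
    WithSeminorms p := by
  refine SeminormFamily.withSeminorms_iff_nhds_eq_iInf p |>.2 (le_antisymm ?_ fun U hU => ?_)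
  · exact le_iInf fun i => by simpa using ((hp i).tendsto 0).le_comap
  · obtain ⟨i, hi⟩ := hbasis U hU
    exact Filter.mem_iInf_of_mem i ⟨Set.Iio 1, Iio_mem_nhds one_pos, hi⟩

theorem IsNuclearSpace.exists_seminorm_seq [FirstCountableTopology L]
    (hk : IsUltrametricOrRCLike k) (hL : IsNuclearSpace k L) (hlc : IsLocallyConvex k L) :
    ∃ (p : ℕ → Seminorm k L) (Λ : ℕ → ℝ), (∀ m, IsConvexSeminorm k (p m)) ∧ Monotone p ∧
      WithSeminorms p ∧ ∀ m, IsFiniteRankApprox (p m) (p (m + 1)) (Λ m) := by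
  obtain ⟨A, hA⟩ := (𝓝 (0 : L)).exists_antitone_basis
  choose r hrc hr hrA using fun n => hlc (A n) (hA.mem n)
  have next (n : ℕ) (p : {p : Seminorm k L // IsConvexSeminorm k p ∧ Continuous p}) :
      ∃ q : {p : Seminorm k L // IsConvexSeminorm k p ∧ Continuous p},
        p.1 ≤ q.1 ∧ r n ≤ q.1 ∧ ∃ Λ, IsFiniteRankApprox p.1 q.1 Λ := by
    obtain ⟨p, hpc, hp⟩ := p
    obtain ⟨q, hqc, hq, hle, Λ, hΛ⟩ := hL.exists_isFiniteRankApprox hk (hpc.sup (hrc n))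
      (by rw [Seminorm.coe_sup]; exact hp.sup (hr n))
    exact ⟨⟨q, hqc, hq⟩, le_sup_left.trans hle, le_sup_right.trans hle, Λ, hΛ.mono le_sup_left⟩
  choose succ hsucc hrsucc Λ hΛ using next
  let p (m : ℕ) : {p : Seminorm k L // IsConvexSeminorm k p ∧ Continuous p} :=
    m.rec ⟨r 0, hrc 0, hr 0⟩ succ
  refine ⟨fun m => (p m).1, fun m => Λ m (p m), fun m => (p m).2.1,
    monotone_nat_of_le_succ fun m => hsucc m (p m),
    withSeminorms_of_continuous (fun m => (p m).2.2) fun U hU => ?_, fun m => hΛ m (p m)⟩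
  obtain ⟨m, hm⟩ := hA.mem_iff.1 hU
  exact ⟨m + 1, fun x hx => hm (hrA m ((hrsucc m (p m) x).trans_lt hx))⟩

end Approximation

section SeminormDisc

variable {k : Type*} [NontriviallyNormedField k]

theorem isDisc_setOf_forall_seminorm_le {ι V : Type*} [AddCommGroup V] [Module k V]
    {p : ι → Seminorm k V} (hpc : ∀ i, IsConvexSeminorm k (p i)) {C : ι → ℝ} (hC : ∀ i, 0 ≤ C i) :
    IsDisc k {x | ∀ i, p i x ≤ C i} := by
  refine ⟨⟨0, fun i => by simpa using hC i⟩, fun x hx y hy a b hab i => ?_⟩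
  have hax : p i (a • x) ≤ ‖a‖ * C i := by rw [map_smul_eq_mul]; gcongr; exact hx i
  have hby : p i (b • y) ≤ ‖b‖ * C i := by rw [map_smul_eq_mul]; gcongr; exact hy i
  obtain hab | ⟨hu, ha, hb⟩ := hab
  · calc p i (a • x + b • y) ≤ ‖a‖ * C i + ‖b‖ * C i :=
          (map_add_le_add _ _ _).trans (add_le_add hax hby)
      _ = (‖a‖ + ‖b‖) * C i := (add_mul _ _ _).symm
      _ ≤ C i := mul_le_of_le_one_left (hC i) hab
  · exact (hpc i hu _ _).trans (max_le (hax.trans (mul_le_of_le_one_left (hC i) ha))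
      (hby.trans (mul_le_of_le_one_left (hC i) hb)))

theorem isBanachDisc_setOf_forall_seminorm_le {ι V : Type*} [AddCommGroup V]
    [Module k V] [UniformSpace V] [IsUniformAddGroup V] [CompleteSpace V]
    {p : ι → Seminorm k V} (hp : WithSeminorms p) (hpc : ∀ i, IsConvexSeminorm k (p i))
    {C : ι → ℝ} (hC : ∀ i, 0 ≤ C i) : IsBanachDisc k {x | ∀ i, p i x ≤ C i} := by
  have := hp.continuousSMul
  refine (isDisc_setOf_forall_seminorm_le hpc hC).isBanachDisc_of_isClosed
    (hp.isVonNBounded_iff_seminorm_bddAbove.2 fun i => ⟨C i, ?_⟩) ?_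
  · exact Set.forall_mem_image.2 fun x hx => hx i
  · rw [Set.ofPred_forall]
    exact isClosed_iInter fun i => isClosed_le (hp.continuous_seminorm i) continuous_const

theorem exists_forall_seminorm_le_of_monotone {V : Type*} [AddCommGroup V] [Module k V]
    {p : ℕ → Seminorm k V} (hmono : Monotone p) {κ : ℕ → Type*} [∀ m, Finite (κ m)]
    {y : ∀ m, κ m → V} (hy : ∀ m i, p m (y m i) ≤ 1) (j : ℕ) :
    ∃ C, 0 ≤ C ∧ ∀ m i, p j (y m i) ≤ C := by
  obtain ⟨C, hC⟩ := ((Set.finite_lt_nat j).biUnion fun m _ =>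
    Set.finite_range fun i => p j (y m i)).bddAbove
  refine ⟨max 1 C, zero_le_one.trans (le_max_left _ _), fun m i => ?_⟩
  obtain hmj | hjm := lt_or_ge m j
  · exact (hC (Set.mem_biUnion hmj ⟨i, rfl⟩)).trans (le_max_right _ _)
  · exact ((hmono hjm _).trans (hy m i)).trans (le_max_left _ _)

theorem bddAbove_image_of_isVonNBounded {V : Type*} [AddCommGroup V] [Module k V]
    [TopologicalSpace V] {p : Seminorm k V} (hp : Continuous p) {B : Set V}
    (hB : Bornology.IsVonNBounded k B) : BddAbove (p '' B) := by
  obtain ⟨c, hc⟩ := (hB (hp.continuousAt.eventually_lt continuousAt_const (by simp) :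
    {x | p x < 1} ∈ 𝓝 0)).exists
  refine ⟨‖c‖, Set.forall_mem_image.2 fun x hx => ?_⟩
  obtain ⟨y, hy : p y < 1, rfl⟩ := hc hx
  simpa only [map_smul_eq_mul] using mul_le_of_le_one_right (norm_nonneg c) hy.le

theorem tendsto_of_seminorm_sub_le {V : Type*} [AddCommGroup V] [Module k V] [TopologicalSpace V]
    {p : ℕ → Seminorm k V} (hp : WithSeminorms p) (hmono : Monotone p) {x : ℕ → V} {y : V}
    {ε : ℕ → ℝ} (hε : Tendsto ε atTop (𝓝 0)) (hx : ∀ m, p m (x m - y) ≤ ε m) :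
    Tendsto x atTop (𝓝 y) := by
  refine (hp.tendsto_nhds _ _).2 fun j δ hδ => ?_
  filter_upwards [eventually_ge_atTop j, hε.eventually_lt_const hδ] with m hjm hm
  exact ((hmono hjm _).trans (hx m)).trans_lt hm

end SeminormDisc

section Target

variable {k : Type*} [NontriviallyNormedField k]
variable {E : Type*} [AddCommGroup E] [Module k E] [TopologicalSpace E] [ContinuousSMul k E]

theorem equicontinuous_of_forall_mem_polar [IsTopologicalAddGroup E] {ι : Type*} {U : Set E}
    (hU : U ∈ 𝓝 0) {x : ι → StrongDual k E} (hx : ∀ i, x i ∈ StrongDual.polar k U) :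
    Equicontinuous fun i => (x i : E → k) := by
  refine equicontinuous_of_equicontinuousAt_zero (fun i => (x i : E →+ k)) ?_
  refine Metric.equicontinuousAt_iff_right.2 fun ε hε => ?_
  obtain ⟨d, hd, hdε⟩ := NormedField.exists_norm_lt k hε
  filter_upwards [(set_smul_mem_nhds_zero_iff (norm_pos_iff.1 hd)).2 hU]
  rintro _ ⟨e, he, rfl⟩ i
  have hxe : ‖x i (d • e)‖ < ε := by
    rw [map_smul, norm_smul]
    exact (mul_le_of_le_one_right hd.le (hx i e he)).trans_lt hdε
  simpa using hxe

theorem hasSum_apply_of_mem_nhds_zero {L : Type*} [AddCommGroup L] [Module k L]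
    [TopologicalSpace L] [ContinuousConstSMul k L] {ι : Type*} {g : ι → E →ₗ[k] L} {f : E →ₗ[k] L}
    {U : Set E} (hU : U ∈ 𝓝 0) (h : ∀ e ∈ U, HasSum (fun i => g i e) (f e)) (e : E) :
    HasSum (fun i => g i e) (f e) := by
  obtain ⟨a, ha⟩ := (absorbent_nhds_zero (𝕜 := k) hU e).exists
  obtain ⟨u, hu, rfl⟩ := ha (Set.mem_singleton e)
  simpa only [map_smul] using (h u hu).const_smul a

variable [IsTopologicalAddGroup E]
variable {L : Type*} [AddCommGroup L] [Module k L] [UniformSpace L] [IsUniformAddGroup L]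
  [CompleteSpace L] [T2Space L]

theorem isNuclearMap_of_summable_hasFiniteExpansion [CompleteSpace k]
    (hk : IsUltrametricOrRCLike k) (hlc : IsLocallyConvex k L) {p : ℕ → Seminorm k L}
    (hp : WithSeminorms p) (hpc : ∀ m, IsConvexSeminorm k (p m)) (hmono : Monotone p) {U : Set E}
    (hU : U ∈ 𝓝 0) {a : ℕ → ℝ} (ha : Summable a) {f : E →L[k] L} {h : ℕ → E →L[k] L}
    (hh : ∀ m, HasFiniteExpansion U (p m) (a m) (h m))
    (hf : ∀ e ∈ U, Tendsto (fun M => ∑ m ∈ Finset.range M, h m e) atTop (𝓝 (f e))) :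
    IsNuclearMap f := by
  have := hp.continuousSMul
  choose κ _ c x y hc hx hy hsum using hh
  choose C hC0 hC using exists_forall_seminorm_le_of_monotone hmono hy
  have hB := isBanachDisc_setOf_forall_seminorm_le hp hpc hC0
  have hcs : Summable fun i : Σ m, κ m => c i.1 i.2 := summable_of_coeffNorm_sigma_le ha hc
  refine isNuclearMap_of_countable (fun i : Σ m, κ m => c i.1 i.2) (fun i => x i.1 i.2)
    (fun i => y i.1 i.2) _ hcs (equicontinuous_of_forall_mem_polar hU fun i => hx i.1 i.2) hB
    (fun i j => hC j i.1 i.2) ?_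
  suffices key : ∀ e ∈ U, HasSum (fun i : Σ m, κ m => c i.1 i.2 • x i.1 i.2 e • y i.1 i.2) (f e) by
    let g (i : Σ m, κ m) : E →L[k] L := (c i.1 i.2 • x i.1 i.2).smulRight (y i.1 i.2)
    exact hasSum_apply_of_mem_nhds_zero (f := (f : E →ₗ[k] L)) (g := fun i => (g i : E →ₗ[k] L)) hU
      (by simpa [g, mul_smul] using key)
  intro e he
  have hs : Summable fun i : Σ m, κ m => c i.1 i.2 • x i.1 i.2 e • y i.1 i.2 := by
    refine hk.summable_smul hlc hcs fun q _ hq => ?_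
    obtain ⟨D, hD⟩ := bddAbove_image_of_isVonNBounded hq hB.bounded
    refine ⟨D, fun i => ?_⟩
    rw [map_smul_eq_mul]
    exact (mul_le_of_le_one_left (apply_nonneg _ _) (hx i.1 i.2 e he)).trans
      (hD (Set.mem_image_of_mem q fun j => hC j i.1 i.2))
  have hblocks : HasSum (fun m => h m e) (∑' i : Σ m, κ m, c i.1 i.2 • x i.1 i.2 e • y i.1 i.2) :=
    hs.hasSum.sigma fun m => by
      simpa only [hsum m e, mul_smul] using hasSum_fintype fun i => c m i • x m i e • y m i
  rw [tendsto_nhds_unique (hf e he) hblocks.tendsto_sum_nat]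
  exact hs.hasSum

theorem isNuclearMap_of_summable_hasFiniteExpansion_sub [CompleteSpace k]
    (hk : IsUltrametricOrRCLike k) (hlc : IsLocallyConvex k L) {p : ℕ → Seminorm k L}
    (hp : WithSeminorms p) (hpc : ∀ m, IsConvexSeminorm k (p m)) (hmono : Monotone p) {U : Set E}
    (hU : U ∈ 𝓝 0) {C : ℝ} {a : ℕ → ℝ} (ha : Summable a) {f : E →L[k] L} {g : ℕ → E →L[k] L}
    (hg₀ : HasFiniteExpansion U (p 0) C (g 0))
    (hg : ∀ m, HasFiniteExpansion U (p (m + 1)) (a m) (g (m + 1) - g m))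
    (hf : ∀ e ∈ U, Tendsto (fun m => g m e) atTop (𝓝 (f e))) : IsNuclearMap f := by
  let h : ℕ → E →L[k] L := fun m => m.casesOn (g 0) fun m => g (m + 1) - g m
  have hpartial (e : E) (M : ℕ) : ∑ m ∈ Finset.range (M + 1), h m e = g M e := by
    rw [Finset.sum_range_succ']
    simp [h, Finset.sum_range_sub fun m => g m e]
  refine isNuclearMap_of_summable_hasFiniteExpansion hk hlc hp hpc hmono hU
    (a := fun m => m.casesOn C a) ((summable_nat_add_iff 1).1 ha) (h := h)
    (Nat.rec hg₀ fun m _ => hg m) fun e he => ?_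
  refine (tendsto_add_atTop_iff_nat 1).1 ?_
  simpa only [hpartial] using hf e he

theorem exists_ne_zero_norm_le_and_mul_lt (Λ : ℝ) {r : ℝ} (hr : 0 < r) :
    ∃ μ : k, μ ≠ 0 ∧ ‖μ‖ ≤ r ∧ ‖μ‖ * Λ < r := by
  obtain ⟨μ, hμ0, hμ⟩ := NormedField.exists_norm_lt k (r := r / (1 + |Λ|)) (by positivity)
  rw [lt_div_iff₀ (by positivity), mul_add, mul_one] at hμ
  have h1 : 0 ≤ ‖μ‖ * |Λ| := by positivity
  have h2 : ‖μ‖ * Λ ≤ ‖μ‖ * |Λ| := by gcongr; exact le_abs_self Λ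
  exact ⟨μ, norm_pos_iff.1 hμ0, by linarith, by linarith⟩

theorem IsNuclearSpace.isNuclearMap_of_isVonNBounded_image [CompleteSpace k]
    [FirstCountableTopology L] [ContinuousSMul k L] (hk : IsUltrametricOrRCLike k)
    (hL : IsNuclearSpace k L) (hlc : IsLocallyConvex k L) (f : E →L[k] L) {U : Set E}
    (hU : U ∈ 𝓝 0) (hf : Bornology.IsVonNBounded k (f '' U)) : IsNuclearMap f := by
  obtain ⟨p, Λ, hpc, hmono, hp, hΛ⟩ := hL.exists_seminorm_seq hk hlc
  choose μ hμ0 hμ hμΛ using fun m : ℕ =>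
    exists_ne_zero_norm_le_and_mul_lt (k := k) (Λ (m + 1)) (r := (1 / 2 : ℝ) ^ m) (by positivity)
  have hμ' (m : ℕ) : 0 < ‖μ m‖ := norm_pos_iff.2 (hμ0 m)
  have happrox (m : ℕ) : ∃ (g : E →L[k] L) (C : ℝ), HasFiniteExpansion U (p (m + 2)) C g ∧
      ∀ e ∈ U, p (m + 2) (f e - g e) ≤ min ‖μ m‖ ‖μ (m - 1)‖ / 2 := by
    obtain ⟨D, hD⟩ := bddAbove_image_of_isVonNBounded (hp.continuous_seminorm (m + 3)) hf
    exact (hΛ (m + 2)).exists_hasFiniteExpansion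
      (fun e he => hD (Set.mem_image_of_mem _ (Set.mem_image_of_mem f he)))
      (half_pos (lt_min (hμ' m) (hμ' (m - 1))))
  choose g C hg herr using happrox
  have hsub (m : ℕ) : ∀ e ∈ U, p (m + 2) (g (m + 1) e - g m e) ≤ ‖μ m‖ := fun e he => by
    have hm : p (m + 2) (f e - g m e) ≤ ‖μ m‖ / 2 :=
      (herr m e he).trans (by gcongr; exact min_le_left _ _)
    have hm' : p (m + 2) (f e - g (m + 1) e) ≤ ‖μ m‖ / 2 :=
      (hmono (Nat.le_succ (m + 2)) _).trans
        ((herr (m + 1) e he).trans (by gcongr; exact min_le_right _ _))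
    calc p (m + 2) (g (m + 1) e - g m e)
        = p (m + 2) ((f e - g m e) - (f e - g (m + 1) e)) := by rw [sub_sub_sub_cancel_left]
      _ ≤ ‖μ m‖ / 2 + ‖μ m‖ / 2 := (map_sub_le_add _ _ _).trans (add_le_add hm hm')
      _ = ‖μ m‖ := add_halves _
  refine isNuclearMap_of_summable_hasFiniteExpansion_sub hk hlc hp hpc hmono hU
    summable_geometric_two ((hg 0).mono (hmono (Nat.zero_le 2)) le_rfl)
    (fun m => (hΛ (m + 1)).hasFiniteExpansion
      ((hg (m + 1)).hasFiniteRankOn.sub (hg m).hasFiniteRankOn) (hμ0 m) (hsub m) (hμΛ m))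
    fun e he => tendsto_of_seminorm_sub_le hp hmono
      (tendsto_pow_atTop_nhds_zero_of_lt_one one_half_pos.le one_half_lt_one) fun m => ?_
  calc p m (g m e - f e) = p m (f e - g m e) := map_sub_rev _ _ _
    _ ≤ p (m + 2) (f e - g m e) := hmono (Nat.le_add_right m 2) _
    _ ≤ ‖μ m‖ / 2 := (herr m e he).trans (by gcongr; exact min_le_left _ _)
    _ ≤ (1 / 2) ^ m := (half_le_self (hμ' m).le).trans (hμ m)

end Target

section TateMaps

variable {k : Type*} [NontriviallyNormedField k]
variable {L : Type*} [AddCommGroup L] [Module k L] [TopologicalSpace L] [IsTopologicalAddGroup L]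
variable {G : Type*} [AddCommGroup G] [Module k G] [TopologicalSpace G]

theorem IsFN.barrelledSpace (hL : IsFN k L) : BarrelledSpace k L := by
  let _ : UniformSpace L := IsTopologicalAddGroup.rightUniformSpace L
  have : IsUniformAddGroup L := isUniformAddGroup_of_addCommGroup
  have := hL.continuousSMul
  have := hL.firstCountable
  have := hL.complete
  have := IsUniformAddGroup.uniformity_countably_generated (α := L)
  infer_instance

theorem IsFN.isNuclearMap_of_isVonNBounded_image [CompleteSpace k] [IsTopologicalAddGroup G]
    [ContinuousSMul k G] (hk : IsUltrametricOrRCLike k) (hL : IsFN k L) (f : G →L[k] L) {U : Set G}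
    (hU : U ∈ 𝓝 0) (hf : Bornology.IsVonNBounded k (f '' U)) : IsNuclearMap f := by
  let _ : UniformSpace L := IsTopologicalAddGroup.rightUniformSpace L
  have : IsUniformAddGroup L := isUniformAddGroup_of_addCommGroup
  have := hL.continuousSMul
  have := hL.t2
  have := hL.firstCountable
  have := hL.complete
  exact hL.nuclear.isNuclearMap_of_isVonNBounded_image hk hL.locallyConvex f hU hf

theorem IsFN.isNuclearMap_to_dfn [CompleteSpace k] (hL : IsFN k L) (hG : IsDFN k G)
    (f : L →L[k] G) : IsNuclearMap f := by
  obtain ⟨F, _, _, _, _, hF, ⟨e⟩⟩ := hG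
  have := hL.firstCountable
  have := hF.firstCountable
  have := hF.continuousSMul
  have := hF.barrelledSpace
  let f' : L →L[k] StrongDual k F := (e : G →L[k] StrongDual k F) ∘L f
  obtain ⟨U, hU, U', hU', hfU⟩ := exists_image_subset_polar f'
  have hf' : IsNuclearMap f' := isNuclearMap_of_isNuclearSpace hL.nuclear hL.locallyConvex f' hU
    ((isVonNBounded_polar hU').subset hfU)
  have hf : f = (e.symm : StrongDual k F →L[k] G) ∘L f' := by ext x; simp [f']
  rw [hf]
  exact hf'.comp_left _

theorem IsDFN.isNuclearMap_to_fn [CompleteSpace k] (hk : IsUltrametricOrRCLike k) (hG : IsDFN k G)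
    (hL : IsFN k L) (f : G →L[k] L) : IsNuclearMap f := by
  obtain ⟨F, _, _, _, _, hF, ⟨e⟩⟩ := hG
  have := hL.firstCountable
  have := hL.continuousSMul
  have := hF.firstCountable
  have := hF.continuousSMul
  let f' : StrongDual k F →L[k] L := f ∘L (e.symm : StrongDual k F →L[k] G)
  obtain ⟨U, hU, hfU⟩ := exists_isVonNBounded_image_of_strongDual f'
  have hf' : IsNuclearMap f' := hL.isNuclearMap_of_isVonNBounded_image hk f' hU hfU
  have hf : f = f' ∘L (e : G →L[k] StrongDual k F) := by ext x; simp [f']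
  rw [hf]
  exact hf'.comp_right _

end TateMaps

namespace Decomposition

variable {k : Type*} [NontriviallyNormedField k]
variable {V : Type*} [AddCommGroup V] [Module k V] [TopologicalSpace V] [IsTopologicalAddGroup V]

/-- The same decomposition with the summands exchanged; through it, statements about the components
`V₊ → V₋` yield those about the components `V₋ → V₊`. -/
def swap (D : Decomposition k V) : Decomposition k V := ⟨D.minus, D.plus, D.isTopCompl.symm⟩

theorem projPlus_add_projMinus (D : Decomposition k V) (x : V) :
    (D.projPlus x : V) + D.projMinus x = x :=
  Submodule.projection_add_projection_eq_self D.isTopCompl.isCompl x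

theorem isNuclearMap_comp_of_plus_of_minus {X W : Type*} [AddCommGroup X] [Module k X]
    [TopologicalSpace X] [AddCommGroup W] [Module k W] [TopologicalSpace W]
    [IsTopologicalAddGroup W] (D : Decomposition k V) {u : X →L[k] V} {v : V →L[k] W}
    (hplus : IsNuclearMap (v ∘L D.plus.subtypeL)) (hminus : IsNuclearMap (D.projMinus ∘L u)) :
    IsNuclearMap (v ∘L u) := by
  convert (hplus.comp_right (D.projPlus ∘L u)).add (hminus.comp_left (v ∘L D.minus.subtypeL))
    using 1
  ext x
  simp [← map_add, projPlus_add_projMinus]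

theorem Equivalent.symm {D E : Decomposition k V} (h : D.Equivalent E) : E.Equivalent D :=
  ⟨h.2.2.1, h.2.2.2, h.1, h.2.1⟩

theorem Equivalent.trans {A D B : Decomposition k V} (hAD : A.Equivalent D)
    (hDB : D.Equivalent B) : A.Equivalent B :=
  ⟨D.isNuclearMap_comp_of_plus_of_minus hDB.1 hAD.1,
    D.swap.isNuclearMap_comp_of_plus_of_minus hDB.2.1 hAD.2.1,
    D.isNuclearMap_comp_of_plus_of_minus hAD.2.2.1 hDB.2.2.1,
    D.swap.isNuclearMap_comp_of_plus_of_minus hAD.2.2.2 hDB.2.2.2⟩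

theorem Equivalent.polarization_eq {D E : Decomposition k V} (h : D.Equivalent E) :
    D.polarization = E.polarization :=
  Set.ext fun _ => ⟨h.symm.trans, h.trans⟩

theorem isNuclearMap_offDiagonal_of_offDiagonal {D E : Decomposition k V}
    (hDE : IsNuclearMap (E.projMinus ∘L D.plus.subtypeL))
    (hED : IsNuclearMap (D.projMinus ∘L E.plus.subtypeL)) {g : V →L[k] V}
    (hg : IsNuclearMap (D.projMinus ∘L g ∘L D.plus.subtypeL)) :
    IsNuclearMap (E.projMinus ∘L g ∘L E.plus.subtypeL) := by
  have hgD : IsNuclearMap (E.projMinus ∘L g ∘L D.plus.subtypeL) :=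
    D.isNuclearMap_comp_of_plus_of_minus hDE hg
  exact D.isNuclearMap_comp_of_plus_of_minus (v := E.projMinus ∘L g) hgD hED

variable [CompleteSpace k] {D E : Decomposition k V}

theorem IsTate.equivalent (hk : IsUltrametricOrRCLike k) (hD : D.IsTate) (hE : E.IsTate) :
    D.Equivalent E :=
  ⟨hD.1.isNuclearMap_to_dfn hE.2 _, hD.2.isNuclearMap_to_fn hk hE.1 _,
    hE.1.isNuclearMap_to_dfn hD.2 _, hE.2.isNuclearMap_to_fn hk hD.1 _⟩

theorem IsTate.glres_polarization (hk : IsUltrametricOrRCLike k) (hD : D.IsTate) :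
    GLres D.polarization = Set.univ :=
  Set.eq_univ_of_forall fun _ _ hE =>
    ⟨isNuclearMap_offDiagonal_of_offDiagonal hE.1 hE.2.2.1
      (hD.1.isNuclearMap_to_dfn hD.2 _),
    isNuclearMap_offDiagonal_of_offDiagonal (D := D.swap) (E := swap _) hE.2.1 hE.2.2.2
      (hD.2.isNuclearMap_to_fn hk hD.1 _)⟩

end Decomposition

theorem IsLocalFieldCharZero.completeSpace {k : Type*} [NontriviallyNormedField k]
    (hk : IsLocalFieldCharZero k) : CompleteSpace k :=
  have := hk.locallyCompact
  have := ProperSpace.of_locallyCompactSpace k (E := k)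
  inferInstance

end AnalyticTate

end

theorem mainTheorem5_general {k : Type*} [NontriviallyNormedField k] [CompleteSpace k]
    (hk : AnalyticTate.IsUltrametricOrRCLike k)
    {V : Type*} [AddCommGroup V] [Module k V] [TopologicalSpace V] [IsTopologicalAddGroup V]
    (hV : ∃ D : AnalyticTate.Decomposition k V, D.IsTate) :
    (∀ D E : AnalyticTate.Decomposition k V, D.IsTate → E.IsTate → D.Equivalent E) ∧
    (∃! P : Set (AnalyticTate.Decomposition k V), AnalyticTate.IsTatePolarization P) ∧
    (∀ P : Set (AnalyticTate.Decomposition k V),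
      AnalyticTate.IsTatePolarization P → AnalyticTate.GLres P = Set.univ) := by
  refine ⟨fun D E hD hE => hD.equivalent hk hE, ?_, ?_⟩
  · obtain ⟨D, hD⟩ := hV
    refine ⟨D.polarization, ⟨D, hD, rfl⟩, ?_⟩
    rintro _ ⟨E, hE, rfl⟩
    exact (hE.equivalent hk hD).polarization_eq
  · rintro _ ⟨D, hD, rfl⟩
    exact hD.glres_polarization hk

theorem mainTheorem5 {k : Type*} [NontriviallyNormedField k]
    (hk : AnalyticTate.IsLocalFieldCharZero k)
    {V : Type*} [AddCommGroup V] [Module k V] [TopologicalSpace V] [IsTopologicalAddGroup V]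
    [ContinuousSMul k V] (hV : AnalyticTate.IsAnalyticTateSpace k V) :
    (∀ D E : AnalyticTate.Decomposition k V, D.IsTate → E.IsTate → D.Equivalent E) ∧
    (∃! P : Set (AnalyticTate.Decomposition k V), AnalyticTate.IsTatePolarization P) ∧
    (∀ P : Set (AnalyticTate.Decomposition k V),
      AnalyticTate.IsTatePolarization P → AnalyticTate.GLres P = Set.univ) := by
  have := hk.completeSpace
  exact mainTheorem5_general hk.nonarch_or_arch hV.2
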